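/- For $k\ge 1$ let $E_k=\{0,\dots,k-1\}$. A predicate of arity $r\ge 0$ on $E_k$ is a map $\rho:E_k^r\to\{0,1\}$, identified with a subset of $E_k^r$. A function $f:E_k^n\to E_k$ preserves $\rho$ if applying $f$ coordinatewise to any $n$ tuples of $\rho$ gives a tuple of $\rho$. It is a near-unanimity function if $f(a,b,\dots,b)=f(b,a,b,\dots,b)=\dots=f(b,\dots,b,a)=b$ for all $a,b\in E_k$. A finite set $G$ of predicates on $E_k$ admits a near-unanimity function (of arity $n$) if some near-unanimity function of some arity $\ge 3$ (of arity $n$) preserves every predicate in $G$. Let $ar(G)$ be the maximal arity of a predicate in $G$ ($0$ if $G=\varnothing$), and put $$n(G)=\bigl(k\cdot\max(1,ar(G))\bigr)^{2^{2k^2}+2}.$$ The following problem is algorithmically decidable: given $k$ and a finite set $G$ of predicates on $E_k$ (each listed by its arity and its tuples), decide whether $G$ admits a near-unanimity function. More precisely: 1. for every $k\ge 1$ and every finite set $G$ of predicates on $E_k$, $G$ admits a near-unanimity function if and only if it admits one of arity $n(G)$; 2. $n(G)$ is computable from $k$ and $G$; 3. given $k$, $G$ and $n$, it is decidable whether $G$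 admits a near-unanimity function of arity $n$. -/

import Mathlib

namespace NUF

/-- `R_k`: predicates of arbitrary finite arity on `E_k = {0, …, k - 1}`. -/
abbrev Predicate (k : ℕ) : Type := Σ r : ℕ, ((Fin r → Fin k) → Bool)

/-- The `n`-ary functions on `E_k`. -/
abbrev Op (k n : ℕ) : Type := (Fin n → Fin k) → Fin k

/-- `f` preserves `ρ`: applying `f` coordinatewise to tuples of `ρ` gives a tuple of `ρ`. -/
def Preserves {k m : ℕ} (f : Op k m) (ρ : Predicate k) : Prop :=
  ∀ α : Fin m → Fin ρ.1 → Fin k,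
    (∀ j, ρ.2 (α j) = true) → ρ.2 (fun i => f (fun j => α j i)) = true

/-- `f(b, …, b, a, b, …, b) = b` for all `a`, `b` and every position of `a`. -/
def IsNearUnanimity {k n : ℕ} (f : Op k n) : Prop :=
  ∀ (i : Fin n) (a b : Fin k), f (Function.update (fun _ => b) i a) = b

/-- `G` admits a near-unanimity function of arity `n`. -/
def AdmitsNUFOfArity {k : ℕ} (G : Finset (Predicate k)) (n : ℕ) : Prop :=
  ∃ f : Op k n, IsNearUnanimity f ∧ ∀ ρ ∈ G, Preserves f ρ

/-- `G` admits a near-unanimity function (of some arity at least `3`). -/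
def AdmitsNUF {k : ℕ} (G : Finset (Predicate k)) : Prop :=
  ∃ n : ℕ, 3 ≤ n ∧ AdmitsNUFOfArity G n

/-- The maximal arity of a predicate of `G` (`0` if `G` is empty). -/
def maxArity {k : ℕ} (G : Finset (Predicate k)) : ℕ := G.sup fun ρ => ρ.1

/-- The arity `n(G)`. -/
def nufArity {k : ℕ} (G : Finset (Predicate k)) : ℕ :=
  (k * max 1 (maxArity G)) ^ (2 ^ (2 * k ^ 2) + 2)

/-- The predicate of arity `c.1` that holds exactly at the tuples listed in `c.2`.
Words in `c.2` that are not tuples of elements of `E_k` of length `c.1` have no effect. -/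
def decodePredicate (k : ℕ) (c : ℕ × List (List ℕ)) : Predicate k :=
  ⟨c.1, fun x => decide (List.ofFn (fun i => (x i : ℕ)) ∈ c.2)⟩

/-- Inputs of the decision problem: the size `k` of the ground set and a list of predicates,
each given by its arity and a list of its tuples. -/
abbrev Instance : Type := ℕ × List (ℕ × List (List ℕ))

/-- The finite set of predicates on `E_k` that an input describes. -/
def Instance.predicates (c : Instance) : Finset (Predicate c.1) :=
  (c.2.map (decodePredicate c.1)).toFinset

theorem exists_decodePredicate_eq {k : ℕ} (ρ : Predicate k) :
    ∃ c, decodePredicate k c = ρ := by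
  obtain ⟨r, p⟩ := ρ
  refine ⟨(r, ((Finset.univ.filter fun x => p x = true).toList.map
    fun x => List.ofFn (fun i => (x i : ℕ)))), ?_⟩
  unfold decodePredicate
  congr 1
  funext x
  rw [Bool.eq_iff_iff, decide_eq_true_iff]
  simp only [List.mem_map, Finset.mem_toList, Finset.mem_filter, Finset.mem_univ, true_and]
  constructor
  · rintro ⟨y, hy, h⟩
    have : y = x := by
      funext i
      exact Fin.ext (congrFun (List.ofFn_injective h) i)
    rwa [← this]
  · intro h
    exact ⟨x, h, rfl⟩

/-- Every finite set of predicates is described by some input. -/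
theorem exists_instance {k : ℕ} (G : Finset (Predicate k)) :
    ∃ l : List (ℕ × List (List ℕ)), Instance.predicates (k, l) = G := by
  choose e he using @exists_decodePredicate_eq k
  refine ⟨G.toList.map e, ?_⟩
  ext ρ
  simp [Instance.predicates, he]

end NUF

/-! Let `f` be a near-unanimity polymorphism of some unknown arity `N`, and let `n` be the target
arity. The `n`-ary polymorphisms of `G` are the solutions of a constraint system whose variables are
the points of `E_k^n`. Near-unanimity pins values at certain points, each pin labelled by the
exceptional position `i < n`. Releasing the pins with label `i` makes the `i`-th projection a
solution. The claim is that an unsolvable pinned system has too few labels.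

Propagating binary constraints from the pins gives derivation trees. If no tree denotes the empty
set, the derived binary relations form a consistent system. A minimal arc-consistent family of
absorbing domains then consists of singletons, which form a solution
(`System.Consistent.exists_solution`): otherwise a proper absorbing subset could be propagated until
it shrinks the family.

If some tree denotes the empty set, delete leaves until every further deletion makes it satisfiable.
Every label survives, because releasing it restores a solution. At a node, let `D` be the set
denoted below and `E` the set of values admitted from above; these are disjoint. Along a branch no
pair `(D, E)` occurs at two nodes with several nontrivial children, since `f` applied to `N` values
passing one after another from `E` to `D` would yield an element of both (`Tm.not_repeated_state`).
There are at most `3 ^ (k ^ 2)` such pairs, so branching at most `B` allows at most `B ^ 3 ^ (k ^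
2)` leaves (`Tm.pins_le_pow`). This bound does not involve `N` and lies below `nufArity G`.

Decidability follows because operations, coded by base-`k` digits, can be searched with bounded
quantifiers. -/

namespace NUF

/-! ### Labelled derivation trees and deletion of leaves. -/

/-- Trees whose leaves are labelled sets and whose inner nodes are existential conjunctions. -/
inductive Tm (ι X : Type) : Type 1
  | pin (i : ι) (P : Set X) : Tm ι X
  | node (κ : Type) [Fintype κ] (W : X → (κ → X) → Prop) (c : κ → Tm ι X) : Tm ι X

namespace Tm

variable {ι X : Type}

/-- The set denoted by a tree. -/
def sem : Tm ι X → Set X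
  | pin _ P => P
  | node κ W c => {x | ∃ y : κ → X, W x y ∧ ∀ l, y l ∈ (c l).sem}

/-- The number of labelled leaves. -/
def pins : Tm ι X → ℕ
  | pin _ _ => 1
  | node _ _ c => ∑ l, (c l).pins

/-- The tree denoting the whole set. -/
def top : Tm ι X := node Empty (fun _ _ => True) Empty.elim

/-- The set of labels that occur in a tree. -/
def labels : Tm ι X → Set ι
  | pin i _ => {i}
  | node _ _ c => ⋃ l, (c l).labels

open Classical in
/-- Delete the leaves labelled `i`. -/
noncomputable def off (i : ι) : Tm ι X → Tm ι X
  | pin j P => if j = i then top else pin j P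
  | node κ W c => node κ W fun l => (c l).off i

/-- Delete a single labelled leaf. -/
inductive Weak : Tm ι X → Tm ι X → Prop
  | pin (i : ι) (P : Set X) : Weak (pin i P) top
  | node (κ : Type) [Fintype κ] (W : X → (κ → X) → Prop) (c c' : κ → Tm ι X) (l : κ)
      (h : Weak (c l) (c' l)) (h' : ∀ m, m ≠ l → c' m = c m) : Weak (node κ W c) (node κ W c')

theorem mem_sem_top (x : X) : x ∈ (top : Tm ι X).sem :=
  ⟨Empty.elim, trivial, fun l => l.elim⟩

theorem sem_node (κ : Type) [Fintype κ] (W : X → (κ → X) → Prop) (c : κ → Tm ι X) :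
    (node κ W c).sem = {x | ∃ y : κ → X, W x y ∧ ∀ l, y l ∈ (c l).sem} := rfl

theorem Weak.pins_lt {T T' : Tm ι X} (h : Weak T T') : T'.pins < T.pins := by
  induction h with
  | pin i P => simp [top, pins]
  | node κ W c c' l h h' ih =>
    simp only [pins]
    refine Finset.sum_lt_sum (fun m _ => ?_) ⟨l, Finset.mem_univ _, ih⟩
    by_cases hm : m = l
    · subst hm; exact ih.le
    · rw [h' m hm]

theorem Weak.sem_off_subset {T T' : Tm ι X} (h : Weak T T') (i : ι) :
    (T.off i).sem ⊆ (T'.off i).sem := by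
  induction h with
  | pin j P =>
    intro x _
    exact ⟨Empty.elim, trivial, fun l => l.elim⟩
  | node κ W c c' l h h' ih =>
    rintro x ⟨y, hy, hc⟩
    refine ⟨y, hy, fun m => ?_⟩
    by_cases hm : m = l
    · subst hm; exact ih (hc m)
    · beta_reduce
      rw [h' m hm]; exact hc m

theorem sem_off_of_notMem {i : ι} (T : Tm ι X) (h : i ∉ T.labels) : (T.off i).sem = T.sem := by
  induction T with
  | pin j P =>
    have : j ≠ i := fun e => h (by simp [labels, e])
    simp [off, this]
  | node κ W c ih =>
    have : ∀ l, i ∉ (c l).labels := fun l hl => h (Set.mem_iUnion.2 ⟨l, hl⟩)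
    simp only [off, sem_node]
    simp [fun l => ih l (this l)]

theorem labels_finite_ncard_le (T : Tm ι X) : T.labels.Finite ∧ T.labels.ncard ≤ T.pins := by
  induction T with
  | pin i P => simp [labels, pins]
  | node κ W c ih =>
    refine ⟨Set.finite_iUnion fun l => (ih l).1, ?_⟩
    simp only [labels, pins]
    classical
    have : (⋃ l, (c l).labels) = ↑(Finset.univ.biUnion fun l => (ih l).1.toFinset) := by
      ext; simp
    rw [this, Set.ncard_coe_finset]
    refine Finset.card_biUnion_le.trans (Finset.sum_le_sum fun l _ => ?_)
    rw [← Set.ncard_eq_toFinset_card _ (ih l).1]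
    exact (ih l).2

theorem exists_weak {T : Tm ι X} (h : T.pins ≠ 0) : ∃ T', Weak T T' := by
  induction T with
  | pin i P => exact ⟨_, Weak.pin i P⟩
  | node κ W c ih =>
    simp only [pins, ne_eq, Finset.sum_eq_zero_iff, Finset.mem_univ, true_implies,
      not_forall] at h
    obtain ⟨l, hl⟩ := h
    obtain ⟨T', hT'⟩ := ih l hl
    classical
    exact ⟨_, Weak.node κ W c (Function.update c l T') l (by simpa using hT')
      fun m hm => by simp [hm]⟩

/-- Below an unsatisfiable tree there is one in which no labelled leaf can be deleted. -/
theorem exists_critical (T : Tm ι X) (hT : T.sem = ∅) :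
    ∃ T' : Tm ι X, Relation.ReflTransGen Weak T T' ∧ T'.sem = ∅ ∧
      ∀ T'', Weak T' T'' → T''.sem.Nonempty := by
  induction hn : T.pins using Nat.strong_induction_on generalizing T with
  | _ n ih =>
    by_cases h : ∃ T₁, Weak T T₁ ∧ T₁.sem = ∅
    · obtain ⟨T₁, h₁, h₂⟩ := h
      obtain ⟨T', h₃, h₄⟩ := ih _ (hn ▸ h₁.pins_lt) T₁ h₂ rfl
      exact ⟨T', .head h₁ h₃, h₄⟩
    · push Not at h
      exact ⟨T, .refl, hT, h⟩

variable {N : ℕ} (F : (Fin N → X) → X)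

/-- `S` is closed under `F`. -/
def ClosedSet (S : Set X) : Prop := ∀ u : Fin N → X, (∀ j, u j ∈ S) → F u ∈ S

/-- `S` absorbs `S'` under `F`. -/
def AbsorbsSet (S S' : Set X) : Prop :=
  ∀ (u : Fin N → X) (j₀ : Fin N), u j₀ ∈ S' → (∀ j, j ≠ j₀ → u j ∈ S) → F u ∈ S

/-- `Z` absorbs `Z'` under `F`. -/
def AbsorbsRel (Z Z' : X → X → Prop) : Prop :=
  ∀ (u v : Fin N → X) (j₀ : Fin N), Z' (u j₀) (v j₀) → (∀ j, j ≠ j₀ → Z (u j) (v j)) →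
    Z (F u) (F v)

/-- All relations of the tree are invariant, its leaves absorb, and it branches at most `B` times
at each node. -/
def Ok (B : ℕ) : Tm ι X → Prop
  | pin _ P => AbsorbsSet F P Set.univ
  | node κ W c => Fintype.card κ ≤ B ∧
      (∀ (u : Fin N → X) (v : Fin N → κ → X), (∀ j, W (u j) (v j)) →
        W (F u) fun l => F fun j => v j l) ∧ ∀ l, (c l).Ok B

variable {F} {B : ℕ}

theorem Weak.ok {T T' : Tm ι X} (h : Weak T T') (hT : T.Ok F B) : T'.Ok F B := by
  induction h with
  | pin i P => exact ⟨by simp, fun _ _ _ => trivial, fun l => l.elim⟩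
  | node κ W c c' l h h' ih =>
    refine ⟨hT.1, hT.2.1, fun m => ?_⟩
    by_cases hm : m = l
    · subst hm; exact ih (hT.2.2 m)
    · rw [h' m hm]; exact hT.2.2 m

theorem Ok.closedSet [NeZero N] {T : Tm ι X} (h : T.Ok F B) : ClosedSet F T.sem := by
  induction T with
  | pin i P => exact fun u hu => h u 0 (Set.mem_univ _) fun j _ => hu j
  | node κ W c ih =>
    intro u hu
    choose v hv hv' using hu
    exact ⟨_, h.2.1 u v hv, fun l => ih l (h.2.2 l) _ fun j => hv' j l⟩

/-- At the deleted leaf this is absorption of the whole set. It lifts through the nodes because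
their relations are invariant and the unchanged children denote closed sets. -/
theorem Weak.absorbsSet [NeZero N] {T T' : Tm ι X} (h : Weak T T') (hT : T.Ok F B) :
    AbsorbsSet F T.sem T'.sem := by
  induction h with
  | pin i P => exact fun u j₀ _ hu => hT u j₀ (Set.mem_univ _) hu
  | node κ W c c' l h h' ih =>
    intro u j₀ h₀ hu
    have : ∀ j, ∃ y : κ → X, W (u j) y ∧ (∀ m, m ≠ l → y m ∈ (c m).sem) ∧
        (j = j₀ → y l ∈ (c' l).sem) ∧ (j ≠ j₀ → y l ∈ (c l).sem) := by
      intro j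
      by_cases hj : j = j₀
      · subst hj
        obtain ⟨y, hy, hy'⟩ := h₀
        exact ⟨y, hy, fun m hm => h' m hm ▸ hy' m, fun _ => hy' l, fun e => (e rfl).elim⟩
      · obtain ⟨y, hy, hy'⟩ := hu j hj
        exact ⟨y, hy, fun m _ => hy' m, fun e => (hj e).elim, fun _ => hy' l⟩
    choose v h₁ h₂ h₃ h₄ using this
    refine ⟨_, hT.2.1 u v h₁, fun m => ?_⟩
    by_cases hm : m = l
    · subst hm
      exact ih (hT.2.2 m) _ j₀ (h₃ j₀ rfl) h₄
    · exact (hT.2.2 m).closedSet _ fun j => h₂ j m hm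

/-! ### The leaf bound for critical trees. -/

/-- A segment that maps a state `(D, E)` to itself contains no deletable leaf. -/
theorem not_repeated_state {D E : Set X} (hD : ClosedSet F D) (hE : ClosedSet F E)
    (hDE : Disjoint D E) {Z Z' : X → X → Prop} (hZ : AbsorbsRel F Z Z')
    (hZD : D = {x | ∃ y ∈ D, Z x y}) (hZE : E = {y | ∃ x ∈ E, Z x y})
    (h : ∃ x ∈ E, ∃ y ∈ D, Z' x y) : False := by
  obtain ⟨x, hx, y, hy, hxy⟩ := h
  have hd : ∀ a : D, ∃ b : D, Z a b := by
    rintro ⟨a, ha⟩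
    rw [hZD] at ha
    obtain ⟨b, hb, hab⟩ := ha
    exact ⟨⟨b, hb⟩, hab⟩
  have he : ∀ b : E, ∃ a : E, Z a b := by
    rintro ⟨b, hb⟩
    rw [hZE] at hb
    obtain ⟨a, ha, hab⟩ := hb
    exact ⟨⟨a, ha⟩, hab⟩
  choose nd hnd using hd
  choose ne hne using he
  let d : ℕ → D := fun i => nd^[i] ⟨y, hy⟩
  let e : ℕ → E := fun i => ne^[i] ⟨x, hx⟩
  have hd' : ∀ i, Z (d i) (d (i + 1)) := fun i => by
    simp only [d, Function.iterate_succ_apply']; exact hnd _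
  have he' : ∀ i, Z (e (i + 1)) (e i) := fun i => by
    simp only [e, Function.iterate_succ_apply']; exact hne _
  -- Token `j` moves inside `E` until time `j`, crosses from `x` to `y` by `Z'`, and then moves
  -- inside `D`. At each time exactly one token crosses, so absorption yields a genuine `Z`-step
  -- between the values of `F`.
  let tok : ℕ → Fin N → X := fun t j => if t ≤ j then e (j - t) else d (t - j - 1)
  have hstep : ∀ t, t < N → Z (F (tok t)) (F (tok (t + 1))) := by
    intro t ht
    refine hZ _ _ ⟨t, ht⟩ ?_ fun j hj => ?_
    · simpa [tok, d, e] using hxy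
    · have hj' : (j : ℕ) ≠ t := fun e => hj (Fin.ext e)
      rcases lt_or_gt_of_ne hj' with h | h
      · have h₁ : ¬ t ≤ (j : ℕ) := by omega
        have h₂ : ¬ t + 1 ≤ (j : ℕ) := by omega
        have h₃ : t + 1 - (j : ℕ) - 1 = (t - j - 1) + 1 := by omega
        simp only [tok, h₁, h₂, if_false, h₃]
        exact hd' _
      · have h₁ : t ≤ (j : ℕ) := by omega
        have h₂ : t + 1 ≤ (j : ℕ) := by omega
        have h₃ : (j : ℕ) - t = (j - (t + 1)) + 1 := by omega
        simp only [tok, h₁, h₂, if_true, h₃]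
        exact he' _
  have h0 : F (tok 0) ∈ E := hE _ fun j => by simp [tok]
  have hN : F (tok N) ∈ D := hD _ fun j => by
    have h : ¬ N ≤ (j : ℕ) := by omega
    simp [tok, h]
  -- Since `D` is its own `Z`-preimage, membership in `D` travels back from time `N` to time `0`,
  -- where the value lies in `E`.
  have hback : ∀ s, s ≤ N → F (tok (N - s)) ∈ D := by
    intro s
    induction s with
    | zero => exact fun _ => hN
    | succ s ih =>
      intro hs
      rw [hZD]
      refine ⟨_, ih (by omega), ?_⟩
      have : N - s = (N - (s + 1)) + 1 := by omega
      rw [this]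
      exact hstep _ (by omega)
  have := hback N le_rfl
  rw [Nat.sub_self] at this
  exact Set.disjoint_left.1 hDE this h0

/-- There are at most `3 ^ |X|` pairs of disjoint subsets of `X`. -/
theorem card_disjoint_pairs_le [Finite X] (S : Finset (Set X × Set X))
    (hS : ∀ p ∈ S, Disjoint p.1 p.2) : S.card ≤ 3 ^ Nat.card X := by
  classical
  have := Fintype.ofFinite X
  have hc : Fintype.card (X → Fin 3) = 3 ^ Nat.card X := by simp
  rw [← hc, ← Finset.card_univ]
  refine Finset.card_le_card_of_injOn
    (fun p x => if x ∈ p.1 then 0 else if x ∈ p.2 then 1 else 2) (fun _ _ => by simp) ?_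
  intro p hp q hq hpq
  have hp' := Set.disjoint_left.1 (hS p hp)
  have hq' := Set.disjoint_left.1 (hS q hq)
  have h : ∀ x, (x ∈ p.1 ↔ x ∈ q.1) ∧ (x ∈ p.2 ↔ x ∈ q.2) := by
    intro x
    have h := congrFun hpq x
    have h₁ := @hp' x
    have h₂ := @hq' x
    by_cases a : x ∈ p.1 <;> by_cases b : x ∈ p.2 <;> by_cases c : x ∈ q.1 <;>
      by_cases d : x ∈ q.2 <;> simp_all
  exact Prod.ext (Set.ext fun x => (h x).1) (Set.ext fun x => (h x).2)

/-- Induction down the tree. `E` holds the values that the context above accepts at the current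
node. `S` records the states of the branching ancestors: `Z` is the relation along the path from
such an ancestor to the current node, and `Z'` the same relation after deleting one leaf off that
path. Each branching node costs a factor `B` and adds a new state to `S`. -/
theorem pins_le_pow [Finite X] [NeZero N] (hB : 1 ≤ B) (T : Tm ι X) (hT : T.Ok F B)
    (S : Finset (Set X × Set X)) (E : Set X) (hE : ClosedSet F E) (hTE : Disjoint T.sem E)
    (hcrit : ∀ T', Weak T T' → (T'.sem ∩ E).Nonempty)
    (hS : ∀ p ∈ S, Disjoint p.1 p.2 ∧ ∃ Z Z' : X → X → Prop, AbsorbsRel F Z Z ∧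
      AbsorbsRel F Z Z' ∧ p.1 = {x | ∃ y ∈ T.sem, Z x y} ∧ E = {y | ∃ x ∈ p.2, Z x y} ∧
      ∃ x ∈ p.2, ∃ y ∈ T.sem, Z' x y) :
    T.pins ≤ B ^ (3 ^ Nat.card X - S.card) := by
  induction T generalizing S E with
  | pin i P => exact Nat.one_le_pow _ _ hB
  | node κ W c ih =>
    classical
    obtain ⟨hκ, hW, hc⟩ := hT
    have hclosed : ClosedSet F (node κ W c).sem := Ok.closedSet (B := B) ⟨hκ, hW, hc⟩
    -- The relation between the value at the node and that at child `l`, with the siblings already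
    -- satisfied.
    let Zl : (κ → Tm ι X) → κ → X → X → Prop := fun c' l x y =>
      ∃ w : κ → X, W x w ∧ w l = y ∧ ∀ m, m ≠ l → w m ∈ (c' m).sem
    have hsem : ∀ (c' : κ → Tm ι X) l, (node κ W c').sem =
        {x | ∃ y ∈ (c' l).sem, Zl c' l x y} := by
      intro c' l
      ext x
      constructor
      · rintro ⟨w, hw, hw'⟩
        exact ⟨w l, hw' l, w, hw, rfl, fun m _ => hw' m⟩
      · rintro ⟨y, hy, w, hw, rfl, hw'⟩
        exact ⟨w, hw, fun m => if hm : m = l then hm ▸ hy else hw' m hm⟩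
    have hZabs : ∀ (c' : κ → Tm ι X) l,
        (∀ m, m ≠ l → AbsorbsSet F (c m).sem (c' m).sem) →
        AbsorbsRel F (Zl c l) (Zl c' l) := by
      intro c' l hc' u v j₀ h₀ h
      have : ∀ j, ∃ w : κ → X, W (u j) w ∧ w l = v j ∧
          (j = j₀ → ∀ m, m ≠ l → w m ∈ (c' m).sem) ∧
          (j ≠ j₀ → ∀ m, m ≠ l → w m ∈ (c m).sem) := by
        intro j
        by_cases hj : j = j₀
        · subst hj
          obtain ⟨w, h₁, h₂, h₃⟩ := h₀
          exact ⟨w, h₁, h₂, fun _ => h₃, fun e => (e rfl).elim⟩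
        · obtain ⟨w, h₁, h₂, h₃⟩ := h j hj
          exact ⟨w, h₁, h₂, fun e => (hj e).elim, fun _ => h₃⟩
      choose w h₁ h₂ h₃ h₄ using this
      refine ⟨_, hW u w h₁, by simp [h₂], fun m hm => ?_⟩
      exact hc' m hm _ j₀ (h₃ j₀ rfl m hm) fun j hj => h₄ j hj m hm
    have hself : ∀ m, AbsorbsSet F (c m).sem (c m).sem := fun m u j₀ h₀ hu =>
      (hc m).closedSet u fun j => if hj : j = j₀ then hj ▸ h₀ else hu j hj
    have hZself : ∀ l, AbsorbsRel F (Zl c l) (Zl c l) := fun l => hZabs c l fun m _ => hself m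
    let El : κ → Set X := fun l => {y | ∃ x ∈ E, Zl c l x y}
    have hEl : ∀ l, ClosedSet F (El l) := by
      intro l u hu
      choose x hx hxu using hu
      exact ⟨F x, hE x hx, hZself l x u 0 (hxu 0) fun j _ => hxu j⟩
    have hdl : ∀ l, Disjoint (c l).sem (El l) := by
      intro l
      rw [Set.disjoint_left]
      rintro y hy ⟨x, hx, hxy⟩
      refine Set.disjoint_left.1 hTE ?_ hx
      rw [hsem c l]
      exact ⟨y, hy, hxy⟩
    have hcl : ∀ l T', Weak (c l) T' → (T'.sem ∩ El l).Nonempty := by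
      intro l T' hT'
      obtain ⟨x, hx, hxE⟩ := hcrit _ (Weak.node κ W c (Function.update c l T') l
        (by simpa using hT') fun m hm => by simp [hm])
      rw [hsem _ l] at hx
      obtain ⟨y, hy, w, hw, hwl, hwm⟩ := hx
      refine ⟨y, by simpa using hy, x, hxE, w, hw, hwl, fun m hm => ?_⟩
      simpa [hm] using hwm m hm
    have hSl : ∀ l, ∀ p ∈ S, Disjoint p.1 p.2 ∧ ∃ Z Z' : X → X → Prop, AbsorbsRel F Z Z ∧
        AbsorbsRel F Z Z' ∧ p.1 = {x | ∃ y ∈ (c l).sem, Z x y} ∧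
        El l = {y | ∃ x ∈ p.2, Z x y} ∧ ∃ x ∈ p.2, ∃ y ∈ (c l).sem, Z' x y := by
      intro l p hp
      obtain ⟨hdis, Z, Z', h₁, h₂, h₃, h₄, x, hx, y, hy, hxy⟩ := hS p hp
      have hcomp : ∀ Z' : X → X → Prop, AbsorbsRel F Z Z' →
          AbsorbsRel F (fun x z => ∃ y, Z x y ∧ Zl c l y z)
            (fun x z => ∃ y, Z' x y ∧ Zl c l y z) := by
        intro Z' hZ' u v j₀ h₀ hu
        have : ∀ j, ∃ y, (j = j₀ → Z' (u j) y) ∧ (j ≠ j₀ → Z (u j) y) ∧ Zl c l y (v j) := by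
          intro j
          by_cases hj : j = j₀
          · subst hj
            obtain ⟨y, a, b⟩ := h₀
            exact ⟨y, fun _ => a, fun e => (e rfl).elim, b⟩
          · obtain ⟨y, a, b⟩ := hu j hj
            exact ⟨y, fun e => (hj e).elim, fun _ => a, b⟩
        choose y a b d using this
        exact ⟨F y, hZ' u y j₀ (a j₀ rfl) b, hZself l y v j₀ (d j₀) fun j _ => d j⟩
      refine ⟨hdis, _, _, hcomp Z h₁, hcomp Z' h₂, ?_, ?_, ?_⟩
      · rw [h₃, hsem c l]
        ext a
        constructor
        · rintro ⟨b, ⟨d, hd, hbd⟩, hab⟩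
          exact ⟨d, hd, b, hab, hbd⟩
        · rintro ⟨d, hd, b, hab, hbd⟩
          exact ⟨b, ⟨d, hd, hbd⟩, hab⟩
      · ext a
        simp only [El, h₄]
        constructor
        · rintro ⟨b, ⟨d, hd, hbd⟩, hab⟩
          exact ⟨d, hd, b, hbd, hab⟩
        · rintro ⟨d, hd, b, hab, hbd⟩
          exact ⟨b, ⟨d, hd, hab⟩, hbd⟩
      · rw [hsem c l] at hy
        obtain ⟨z, hz, hyz⟩ := hy
        exact ⟨x, hx, z, hz, y, hxy, hyz⟩
    by_cases hbr : ∃ l l', l ≠ l' ∧ (c l).pins ≠ 0 ∧ (c l').pins ≠ 0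
    · obtain ⟨l₁, l₂, hl, hl₁, hl₂⟩ := hbr
      -- A repeated state would give a segment mapping the state to itself while an off-path leaf is
      -- deletable.
      have hnew : ((node κ W c).sem, E) ∉ S := by
        intro hmem
        obtain ⟨hdis, Z, Z', h₁, h₂, h₃, h₄, h₅⟩ := hS _ hmem
        exact not_repeated_state hclosed hE hTE h₂ h₃ h₄ h₅
      have hS' : ∀ l, ∀ p ∈ insert ((node κ W c).sem, E) S, Disjoint p.1 p.2 ∧
          ∃ Z Z' : X → X → Prop, AbsorbsRel F Z Z ∧
          AbsorbsRel F Z Z' ∧ p.1 = {x | ∃ y ∈ (c l).sem, Z x y} ∧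
          El l = {y | ∃ x ∈ p.2, Z x y} ∧ ∃ x ∈ p.2, ∃ y ∈ (c l).sem, Z' x y := by
        intro l p hp
        rcases Finset.mem_insert.1 hp with rfl | hp
        -- The `Z'` required for the new state comes from deleting a leaf in a sibling of `l`; this
        -- is why only nodes with two nontrivial children are recorded.
        · obtain ⟨l', hl', hp'⟩ : ∃ l', l' ≠ l ∧ (c l').pins ≠ 0 := by
            by_cases h : l₁ = l
            · exact ⟨l₂, fun e => hl (h.trans e.symm), hl₂⟩
            · exact ⟨l₁, h, hl₁⟩
          obtain ⟨T', hT'⟩ := exists_weak hp'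
          have hup : Weak (c l') ((Function.update c l' T') l') := by simpa using hT'
          obtain ⟨x, hx, hxE⟩ := hcrit _ (Weak.node κ W c (Function.update c l' T') l'
            hup fun m hm => by simp [hm])
          rw [hsem _ l] at hx
          obtain ⟨y, hy, hxy⟩ := hx
          rw [Function.update_of_ne hl'.symm] at hy
          refine ⟨hTE, Zl c l, Zl (Function.update c l' T') l, hZself l, hZabs _ l ?_,
            hsem c l, rfl, x, hxE, y, hy, hxy⟩
          intro m _
          by_cases hm : m = l'
          · subst hm
            exact hup.absorbsSet (hc m)
          · rw [Function.update_of_ne hm]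
            exact hself m
        · exact hSl l p hp
      -- This keeps the truncated subtraction in the exponent exact.
      have hcard : (insert ((node κ W c).sem, E) S).card ≤ 3 ^ Nat.card X :=
        card_disjoint_pairs_le _ fun p hp => (hS' l₁ p hp).1
      rw [Finset.card_insert_of_notMem hnew] at hcard
      have hle : ∀ l, (c l).pins ≤ B ^ (3 ^ Nat.card X - (S.card + 1)) := by
        intro l
        have := ih l (hc l) _ (El l) (hEl l) (hdl l) (hcl l) (hS' l)
        rwa [Finset.card_insert_of_notMem hnew] at this
      calc ∑ l, (c l).pins ≤ ∑ _l : κ, B ^ (3 ^ Nat.card X - (S.card + 1)) :=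
            Finset.sum_le_sum fun l _ => hle l
        _ = Fintype.card κ * B ^ (3 ^ Nat.card X - (S.card + 1)) := by simp
        _ ≤ B * B ^ (3 ^ Nat.card X - (S.card + 1)) := Nat.mul_le_mul_right _ hκ
        _ = B ^ (3 ^ Nat.card X - S.card) := by
            rw [← pow_succ']
            congr 1
            omega
    · push Not at hbr
      by_cases h0 : ∃ l, (c l).pins ≠ 0
      · obtain ⟨l, hl⟩ := h0
        have : ∑ l, (c l).pins = (c l).pins :=
          Finset.sum_eq_single l (fun m _ hm => hbr l m hm.symm hl) (by simp)
        simp only [pins, this]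
        exact ih l (hc l) S (El l) (hEl l) (hdl l) (hcl l) (hSl l)
      · push Not at h0
        simp [pins, h0]

/-- An unsatisfiable tree that becomes satisfiable when the leaves with any one label are deleted
has a bounded number of labels. -/
theorem card_labels_le [Finite X] [NeZero N] (hB : 1 ≤ B) (T : Tm ι X) (hT : T.Ok F B)
    (hemp : T.sem = ∅) (hoff : ∀ i, (T.off i).sem.Nonempty) :
    Nat.card ι ≤ B ^ 3 ^ Nat.card X := by
  obtain ⟨T', hTT', hemp', hcrit⟩ := exists_critical T hemp
  have hok : T'.Ok F B := by
    clear hemp' hcrit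
    induction hTT' with
    | refl => exact hT
    | tail _ h ih => exact h.ok ih
  have hoff' : ∀ i, (T'.off i).sem.Nonempty := by
    intro i
    clear hemp' hcrit hok
    induction hTT' with
    | refl => exact hoff i
    | tail _ h ih => exact ih.mono (h.sem_off_subset i)
  -- Releasing an absent label changes nothing, so the tree would stay unsatisfiable.
  have hlab : T'.labels = Set.univ := by
    refine Set.eq_univ_of_forall fun i => ?_
    by_contra hi
    have := hoff' i
    rw [sem_off_of_notMem T' hi, hemp'] at this
    exact Set.not_nonempty_empty this
  have h₁ := (labels_finite_ncard_le T').2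
  rw [hlab, Set.ncard_univ] at h₁
  have h₂ := pins_le_pow hB T' hok ∅ Set.univ (fun _ _ => Set.mem_univ _) (by simp [hemp'])
    (by simpa using hcrit) (by simp)
  simpa using h₁.trans h₂

end Tm

/-! ### Walks around closed paths, and absorption along them. -/

open Tm (AbsorbsSet AbsorbsRel)

section Walks

variable {V A 𝓔 : Type} (src tgt : 𝓔 → V)

/-- `l` is a list of consecutive steps from `x` to `y`. -/
def IsPath : V → List 𝓔 → V → Prop
  | x, [], y => x = y
  | x, e :: l, y => src e = x ∧ IsPath (tgt e) l y

/-- Composition of the relations of the steps of a list. -/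
def walk (S : 𝓔 → A → A → Prop) : List 𝓔 → A → A → Prop
  | [], a, b => a = b
  | e :: l, a, b => ∃ a', S e a a' ∧ walk S l a' b

/-- The vertex `u` lies on the closed path `q` at `y`. -/
def OnPath (y : V) (q : List 𝓔) (u : V) : Prop :=
  ∃ q₁ q₂, q = q₁ ++ q₂ ∧ IsPath src tgt y q₁ u ∧ IsPath src tgt u q₂ y

/-- Connectedness by the pair relations between the vertices of the closed path `q` at `y`. -/
def Conn (R : V → V → A → A → Prop) (y : V) (q : List 𝓔) : V × A → V × A → Prop :=
  Relation.ReflTransGen fun p p' =>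
    OnPath src tgt y q p.1 ∧ OnPath src tgt y q p'.1 ∧ R p.1 p'.1 p.2 p'.2

/-- The `n`-fold repetition of a list. -/
def lpow (q : List 𝓔) (n : ℕ) : List 𝓔 := (List.replicate n q).flatten

variable {src tgt}

theorem lpow_succ (q : List 𝓔) (n : ℕ) : lpow q (n + 1) = q ++ lpow q n := by
  simp [lpow, List.replicate_succ]

theorem lpow_add (q : List 𝓔) (m n : ℕ) : lpow q (m + n) = lpow q m ++ lpow q n := by
  rw [lpow, List.replicate_add, List.flatten_append]
  rfl

theorem IsPath.append {x y z : V} {l l' : List 𝓔} (h : IsPath src tgt x l y)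
    (h' : IsPath src tgt y l' z) : IsPath src tgt x (l ++ l') z := by
  induction l generalizing x with
  | nil => obtain rfl : x = y := h; exact h'
  | cons e l ih => exact ⟨h.1, ih h.2⟩

theorem IsPath.lpow {y : V} {q : List 𝓔} (h : IsPath src tgt y q y) (n : ℕ) :
    IsPath src tgt y (lpow q n) y := by
  induction n with
  | zero => exact rfl
  | succ n ih => rw [lpow_succ]; exact h.append ih

theorem walk_append {S : 𝓔 → A → A → Prop} {l l' : List 𝓔} {a c : A} :
    walk S (l ++ l') a c ↔ ∃ b, walk S l a b ∧ walk S l' b c := by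
  induction l generalizing a with
  | nil => exact ⟨fun h => ⟨a, rfl, h⟩, fun ⟨b, hb, h⟩ => by obtain rfl : a = b := hb; exact h⟩
  | cons e l ih =>
    constructor
    · rintro ⟨a', h, h'⟩
      obtain ⟨b, hb, hb'⟩ := ih.1 h'
      exact ⟨b, ⟨a', h, hb⟩, hb'⟩
    · rintro ⟨b, ⟨a', h, hb⟩, hb'⟩
      exact ⟨a', h, ih.2 ⟨b, hb, hb'⟩⟩

theorem walk_mono {S S' : 𝓔 → A → A → Prop} (h : ∀ e a b, S' e a b → S e a b) {l : List 𝓔}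
    {a b : A} (hw : walk S' l a b) : walk S l a b := by
  induction l generalizing a with
  | nil => exact hw
  | cons e l ih =>
    obtain ⟨a', h₁, h₂⟩ := hw
    exact ⟨a', h _ _ _ h₁, ih h₂⟩

theorem absorbsRel_walk {N : ℕ} [NeZero N] {f : (Fin N → A) → A} {S S' : 𝓔 → A → A → Prop}
    (h : ∀ e, AbsorbsRel f (S' e) (S e)) (l : List 𝓔) :
    AbsorbsRel f (walk S' l) (walk S l) := by
  induction l with
  | nil =>
    intro u v j₀ h₀ hu
    have : u = v := funext fun j => if hj : j = j₀ then hj ▸ h₀ else hu j hj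
    exact congrArg f this
  | cons e l ih =>
    intro u v j₀ h₀ hu
    have : ∀ j, ∃ w, (j = j₀ → S e (u j) w ∧ walk S l w (v j)) ∧
        (j ≠ j₀ → S' e (u j) w ∧ walk S' l w (v j)) := by
      intro j
      by_cases hj : j = j₀
      · subst hj
        obtain ⟨w, hw⟩ := h₀
        exact ⟨w, fun _ => hw, fun e => (e rfl).elim⟩
      · obtain ⟨w, hw⟩ := hu j hj
        exact ⟨w, fun e => (hj e).elim, fun _ => hw⟩
    choose w h₁ h₂ using this
    exact ⟨f w, h e u w j₀ (h₁ j₀ rfl).1 fun j hj => (h₂ j hj).1,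
      ih w v j₀ (h₁ j₀ rfl).2 fun j hj => (h₂ j hj).2⟩

variable {S S' : 𝓔 → A → A → Prop} {R : V → V → A → A → Prop}

/-- The relation to the endpoint `z` is carried along every step, and on arrival at `z` the diagonal
relation forces equality. Hence a related pair is joined along every path. -/
theorem walk_of_rel (hdiag : ∀ x a b, R x x a b → a = b)
    (hstep : ∀ e z a b, R (src e) z a b → ∃ a', S e a a' ∧ R (tgt e) z a' b)
    {x z : V} {l : List 𝓔} {a b : A} (hl : IsPath src tgt x l z) (h : R x z a b) :
    walk S l a b := by
  induction l generalizing x a with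
  | nil => obtain rfl : x = z := hl; exact hdiag _ _ _ h
  | cons e l ih =>
    obtain ⟨rfl, hl⟩ := hl
    obtain ⟨a', h₁, h₂⟩ := hstep e z a b h
    exact ⟨a', h₁, ih hl h₂⟩

theorem Conn.symm (hsymm : ∀ x z a b, R x z a b → R z x b a) {y : V} {q : List 𝓔}
    {p p' : V × A} (h : Conn src tgt R y q p p') : Conn src tgt R y q p' p := by
  induction h with
  | refl => exact .refl
  | tail _ h ih => exact .head ⟨h.2.1, h.1, hsymm _ _ _ _ h.2.2⟩ ih

theorem conn_of_walk (hSR : ∀ e a b, S e a b → R (src e) (tgt e) a b) {y u v : V}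
    {q q₁ p q₂ : List 𝓔} (hq : q = q₁ ++ (p ++ q₂)) (h₁ : IsPath src tgt y q₁ u)
    (hp : IsPath src tgt u p v) (h₂ : IsPath src tgt v q₂ y) {a c : A} (h : walk S p a c) :
    Conn src tgt R y q (u, a) (v, c) := by
  induction p generalizing q₁ u a with
  | nil =>
    obtain rfl : u = v := hp
    obtain rfl : a = c := h
    exact .refl
  | cons e p ih =>
    obtain ⟨rfl, hp⟩ := hp
    obtain ⟨a', ha', h⟩ := h
    have h₁' : IsPath src tgt y (q₁ ++ [e]) (tgt e) := h₁.append ⟨rfl, rfl⟩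
    refine .head (b := (tgt e, a')) ⟨?_, ?_, hSR _ _ _ ha'⟩ (ih (by simp [hq]) h₁' hp h)
    · exact ⟨q₁, _, hq, h₁, ⟨rfl, hp.append h₂⟩⟩
    · exact ⟨q₁ ++ [e], p ++ q₂, by simp [hq], h₁', hp.append h₂⟩

/-- Each link joins two vertices of the closed path, so it can be realised by walking forward along
the path; the price is extra turns. -/
theorem exists_walk_of_conn (hdiag : ∀ x a b, R x x a b → a = b)
    (hstep : ∀ e z a b, R (src e) z a b → ∃ a', S e a a' ∧ R (tgt e) z a' b)
    {y : V} {q : List 𝓔} {p : V × A} {c : A} (hc : R y y c c)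
    (h : Conn src tgt R y q p (y, c)) {q₂ : List 𝓔} (hq₂ : IsPath src tgt p.1 q₂ y) :
    ∃ n, walk S (q₂ ++ lpow q n) p.2 c := by
  unfold Conn at h
  induction h using Relation.ReflTransGen.head_induction_on generalizing q₂ with
  | refl =>
    refine ⟨0, ?_⟩
    simpa [lpow] using walk_of_rel hdiag hstep hq₂ hc
  | @head p p' hpp' _ ih =>
    obtain ⟨_, ⟨r₁, r₂, hq, hr₁, hr₂⟩, hR⟩ := hpp'
    obtain ⟨n, hn⟩ := ih hr₂
    refine ⟨n + 1, ?_⟩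
    have : q₂ ++ lpow q (n + 1) = (q₂ ++ r₁) ++ (r₂ ++ lpow q n) := by
      simp only [lpow_succ, hq, List.append_assoc]
    rw [this, walk_append]
    exact ⟨p'.2, walk_of_rel hdiag hstep (hq₂.append hr₁) hR, hn⟩

theorem exists_uniform_walk [Finite A] (hdiag : ∀ x a b, R x x a b → a = b)
    (hstep : ∀ e z a b, R (src e) z a b → ∃ a', S e a a' ∧ R (tgt e) z a' b)
    {y : V} {q : List 𝓔} (hq : IsPath src tgt y q y) :
    ∃ L, ∀ a c, R y y a a → R y y c c → Conn src tgt R y q (y, a) (y, c) →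
      walk S (lpow q L) a c := by
  classical
  have : ∀ p : A × A, ∃ n, R y y p.1 p.1 → R y y p.2 p.2 →
      Conn src tgt R y q (y, p.1) (y, p.2) → walk S (lpow q n) p.1 p.2 := by
    intro p
    by_cases h : R y y p.2 p.2 ∧ Conn src tgt R y q (y, p.1) (y, p.2)
    · obtain ⟨n, hn⟩ := exists_walk_of_conn hdiag hstep h.1 h.2 (q₂ := []) rfl
      exact ⟨n, fun _ _ _ => by simpa using hn⟩
    · exact ⟨0, fun _ h₁ h₂ => (h ⟨h₁, h₂⟩).elim⟩
  choose n hn using this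
  obtain ⟨L, hL⟩ := (Set.finite_range n).bddAbove
  refine ⟨L, fun a c ha hc hac => ?_⟩
  have hle : n (a, c) ≤ L := hL ⟨_, rfl⟩
  obtain ⟨d, rfl⟩ := Nat.exists_eq_add_of_le' hle
  rw [lpow_add, walk_append]
  -- Idle turns from `a` back to `a` pad every walk to the common length.
  exact ⟨a, walk_of_rel hdiag hstep (hq.lpow d) ha, hn (a, c) ha hc hac⟩

theorem exists_chain {M : A → A → Prop} {D : Set A} (hD : ∀ d ∈ D, ∃ d' ∈ D, M d' d) {c : A}
    (hc : c ∈ D) : ∃ ch : ℕ → A, ch 0 = c ∧ (∀ i, ch i ∈ D) ∧ ∀ i, M (ch (i + 1)) (ch i) := by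
  have : ∀ d : D, ∃ d' : D, M d' d := fun d =>
    let ⟨d', h, h'⟩ := hD d d.2
    ⟨⟨d', h⟩, h'⟩
  choose g hg using this
  refine ⟨fun i => (g^[i] ⟨c, hc⟩ : D), rfl, fun i => Subtype.coe_prop _, fun i => ?_⟩
  simp only [Function.iterate_succ_apply']
  exact hg _

/-- A set fixed by a closed path contains all values connected to it along the path. -/
theorem mem_of_conn [Finite A] {N : ℕ} [NeZero N] {f : (Fin N → A) → A}
    (hidem : ∀ a, f (fun _ => a) = a)
    (hdiag : ∀ x a b, R x x a b → a = b) (hsymm : ∀ x z a b, R x z a b → R z x b a)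
    (hstep : ∀ e z a b, R (src e) z a b → ∃ a', S e a a' ∧ R (tgt e) z a' b)
    (hSR : ∀ e a b, S e a b → R (src e) (tgt e) a b)
    (hS'S : ∀ e a b, S' e a b → S e a b) (habs : ∀ e, AbsorbsRel f (S' e) (S e))
    {y : V} {q : List 𝓔} (hq : IsPath src tgt y q y) {B D : Set A} (hBD : B ⊆ D)
    (hDR : ∀ d ∈ D, R y y d d) (hD : ∀ d ∈ D, ∃ d' ∈ D, walk S' q d' d)
    (hB : ∀ d ∈ B, ∃ d' ∈ B, walk S' q d' d) (hB' : ∀ d ∈ B, ∀ d', walk S' q d d' → d' ∈ B)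
    {b c : A} (hb : b ∈ B) (hc : c ∈ D) (hbc : Conn src tgt R y q (y, b) (y, c)) : c ∈ B := by
  obtain ⟨L, hL⟩ := exists_uniform_walk (S := S) hdiag hstep hq
  obtain ⟨bc, hbc0, hbcB, hbcw⟩ := exists_chain hB hb
  obtain ⟨cc, hcc0, hccD, hccw⟩ := exists_chain hD hc
  have hconn : ∀ ch : ℕ → A, (∀ i, walk S' q (ch (i + 1)) (ch i)) → ∀ i,
      Conn src tgt R y q (y, ch i) (y, ch 0) := by
    intro ch hch i
    induction i with
    | zero => exact .refl
    | succ i ih =>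
      exact Relation.ReflTransGen.trans (conn_of_walk (q := q) (q₁ := []) (q₂ := []) (p := q)
        hSR (by simp) rfl hq rfl (walk_mono hS'S (hch i))) ih
  have hpow : ∀ ch : ℕ → A, (∀ i, walk S' q (ch (i + 1)) (ch i)) → ∀ L i,
      walk S' (lpow q L) (ch (i + L)) (ch i) := by
    intro ch hch L
    induction L with
    | zero => exact fun i => rfl
    | succ L ih =>
      intro i
      rw [lpow_succ, walk_append]
      exact ⟨_, hch (i + L), ih i⟩
  -- Each backward chain stays in one connected component, and `b`, `c` share one, so any term of
  -- the first chain reaches any term of the second.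
  have hcross : ∀ i j, walk S (lpow q L) (bc i) (cc j) := by
    intro i j
    have h₁ := hconn bc hbcw i
    have h₂ := hconn cc hccw j
    rw [hbc0] at h₁
    rw [hcc0] at h₂
    exact hL _ _ (hDR _ (hBD (hbcB i))) (hDR _ (hccD j)) ((h₁.trans hbc).trans (h₂.symm hsymm))
  have hBpow : ∀ n, ∀ d ∈ B, ∀ d', walk S' (lpow q n) d d' → d' ∈ B := by
    intro n
    induction n with
    | zero => intro d hd d' h; obtain rfl : d = d' := h; exact hd
    | succ n ih =>
      intro d hd d' h
      rw [lpow_succ, walk_append] at h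
      obtain ⟨d₁, h₁, h₂⟩ := h
      exact ih d₁ (hB' d hd d₁ h₁) d' h₂
  -- In round `t`, token `t` alone switches chains, by an `S`-walk; the others follow `S'`. Thus `f`
  -- of the tokens never leaves `B`, going from a constant tuple of the `b`-chain to the constant
  -- tuple `c`.
  let tok : ℕ → Fin N → A := fun t j =>
    if (j : ℕ) < t then cc (L * (N - t)) else bc (L * (N - t))
  have hmem : ∀ t, t ≤ N → f (tok t) ∈ B := by
    intro t
    induction t with
    | zero =>
      intro _
      have : tok 0 = fun _ => bc (L * (N - 0)) := by
        funext j
        simp [tok]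
      rw [this, hidem]
      exact hbcB _
    | succ t ih =>
      intro ht
      refine hBpow L _ (ih (by omega)) _ ?_
      have hidx : L * (N - t) = L * (N - (t + 1)) + L := by
        rw [← Nat.mul_succ]
        congr 1
        omega
      refine absorbsRel_walk habs _ _ _ ⟨t, ht⟩ ?_ fun j hj => ?_
      · simp only [tok, lt_irrefl, if_false, Nat.lt_succ_self, if_true]
        exact hcross _ _
      · have hj' : (j : ℕ) ≠ t := fun e => hj (Fin.ext e)
        by_cases h : (j : ℕ) < t
        · have h' : (j : ℕ) < t + 1 := by omega
          simp only [tok, h, h', if_true, hidx]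
          exact hpow cc hccw L _
        · have h' : ¬ (j : ℕ) < t + 1 := by omega
          simp only [tok, h, h', if_false, hidx]
          exact hpow bc hbcw L _
  have := hmem N le_rfl
  have hN : tok N = fun _ => c := by
    funext j
    simp [tok, hcc0]
  rwa [hN, hidem] at this

end Walks

/-- From every point of a finite directed graph one reaches a terminal strong component. -/
theorem exists_terminal {α : Type} [Finite α] (r : α → α → Prop) (s : α) :
    ∃ t, Relation.ReflTransGen r s t ∧
      ∀ u, Relation.ReflTransGen r t u → Relation.ReflTransGen r u t := by
  obtain ⟨t, ht, hmin⟩ := Set.exists_min_image {t | Relation.ReflTransGen r s t}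
    (fun t => {u | Relation.ReflTransGen r t u}.ncard) (Set.toFinite _) ⟨s, .refl⟩
  refine ⟨t, ht, fun u hu => ?_⟩
  have hsub : {w | Relation.ReflTransGen r u w} ⊆ {w | Relation.ReflTransGen r t w} :=
    fun w hw => hu.trans hw
  have heq := Set.eq_of_subset_of_ncard_le hsub (hmin u (ht.trans hu)) (Set.toFinite _)
  have : t ∈ {w | Relation.ReflTransGen r t w} := .refl
  rw [← heq] at this
  exact this

/-! ### Consistent systems and shrinking of absorbing domains. -/

/-- Constraint systems with variables in `V` and values in `A`. -/
structure System (V A : Type) where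
  /-- the constraints -/
  J : Type
  /-- the arity of a constraint -/
  ar : J → ℕ
  /-- the relation of a constraint -/
  rel : (j : J) → (Fin (ar j) → A) → Prop
  /-- the variables of a constraint -/
  scope : (j : J) → Fin (ar j) → V

namespace System

variable {V A : Type} (C : System V A) (R : V → V → A → A → Prop) {N : ℕ} (f : (Fin N → A) → A)

/-- The pair relations `R` are consistent with the constraints and invariant under `f`. -/
structure Consistent : Prop where
  eq_of_diag : ∀ x a b, R x x a b → a = b
  symm : ∀ x z a b, R x z a b → R z x b a
  diag : ∀ x z a b, R x z a b → R x x a a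
  closed : ∀ x z (u v : Fin N → A), (∀ j, R x z (u j) (v j)) → R x z (f u) (f v)
  rel_closed : ∀ j (u : Fin N → Fin (C.ar j) → A), (∀ t, C.rel j (u t)) →
    C.rel j fun l => f fun t => u t l
  extend : ∀ j i z a b, R (C.scope j i) z a b → ∃ s, C.rel j s ∧ s i = a ∧
    (∀ l, R (C.scope j l) z (s l) b) ∧ ∀ l m, R (C.scope j l) (C.scope j m) (s l) (s m)
  nonempty : ∀ x, ∃ a, R x x a a

/-- Tuples of a constraint that respect the pair relations and the domains `D`. -/
def Loc (D : V → Set A) (j : C.J) (s : Fin (C.ar j) → A) : Prop :=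
  C.rel j s ∧ (∀ l m, R (C.scope j l) (C.scope j m) (s l) (s m)) ∧ ∀ l, s l ∈ D (C.scope j l)

/-- Steps between two variables of a constraint. -/
abbrev Step : Type := Σ j : C.J, Fin (C.ar j) × Fin (C.ar j)

/-- The source of a step. -/
def src (e : C.Step) : V := C.scope e.1 e.2.1

/-- The target of a step. -/
def tgt (e : C.Step) : V := C.scope e.1 e.2.2

/-- The relation of a step within the domains `D`. -/
def stepRel (D : V → Set A) (e : C.Step) (a b : A) : Prop :=
  ∃ s, C.Loc R D e.1 s ∧ s e.2.1 = a ∧ s e.2.2 = b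

/-- Arc-consistent absorbing families of domains. -/
structure Adm (D : V → Set A) : Prop where
  sub : ∀ x, ∀ a ∈ D x, R x x a a
  nonempty : ∀ x, (D x).Nonempty
  absorbs : ∀ x, AbsorbsSet f (D x) {a | R x x a a}
  arc : ∀ j i, ∀ a ∈ D (C.scope j i), ∃ s, C.Loc R D j s ∧ s i = a

variable {C R f}

theorem Consistent.adm [NeZero N] (h : C.Consistent R f) :
    C.Adm R f fun x => {a | R x x a a} where
  sub _ _ ha := ha
  nonempty := h.nonempty
  absorbs x u j₀ h₀ hu := h.closed x x u u fun j => if hj : j = j₀ then hj ▸ h₀ else hu j hj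
  arc j i a ha := by
    obtain ⟨s, h₁, h₂, h₃, h₄⟩ := h.extend j i _ a a ha
    exact ⟨s, ⟨h₁, h₄, fun l => h.diag _ _ _ _ (h₃ l)⟩, h₂⟩

theorem Consistent.stepRel_extend (h : C.Consistent R f) (e : C.Step) (z : V) (a b : A)
    (hR : R (C.src e) z a b) :
    ∃ a', C.stepRel R (fun _ => Set.univ) e a a' ∧ R (C.tgt e) z a' b := by
  obtain ⟨s, h₁, h₂, h₃, h₄⟩ := h.extend e.1 e.2.1 z a b hR
  exact ⟨s e.2.2, ⟨s, ⟨h₁, h₄, fun _ => Set.mem_univ _⟩, h₂, rfl⟩, h₃ _⟩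

theorem stepRel_rel {D : V → Set A} (e : C.Step) (a b : A) (h : C.stepRel R D e a b) :
    R (C.src e) (C.tgt e) a b := by
  obtain ⟨s, hs, rfl, rfl⟩ := h
  exact hs.2.1 _ _

theorem stepRel_univ {D : V → Set A} (e : C.Step) (a b : A) (h : C.stepRel R D e a b) :
    C.stepRel R (fun _ => Set.univ) e a b := by
  obtain ⟨s, hs, h⟩ := h
  exact ⟨s, ⟨hs.1, hs.2.1, fun _ => Set.mem_univ _⟩, h⟩

theorem Consistent.absorbsRel_stepRel (h : C.Consistent R f) {D : V → Set A}
    (hD : C.Adm R f D) (e : C.Step) :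
    AbsorbsRel f (C.stepRel R D e) (C.stepRel R (fun _ => Set.univ) e) := by
  intro u v j₀ h₀ hu
  have : ∀ t, ∃ s, C.Loc R (fun _ => Set.univ) e.1 s ∧ s e.2.1 = u t ∧ s e.2.2 = v t ∧
      (t ≠ j₀ → ∀ l, s l ∈ D (C.scope e.1 l)) := by
    intro t
    by_cases ht : t = j₀
    · subst ht
      obtain ⟨s, hs, h₁, h₂⟩ := h₀
      exact ⟨s, hs, h₁, h₂, fun e => (e rfl).elim⟩
    · obtain ⟨s, hs, h₁, h₂⟩ := hu t ht
      exact ⟨s, ⟨hs.1, hs.2.1, fun _ => Set.mem_univ _⟩, h₁, h₂, fun _ => hs.2.2⟩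
  choose s h₁ h₂ h₃ h₄ using this
  refine ⟨fun l => f fun t => s t l, ⟨h.rel_closed _ s fun t => (h₁ t).1, fun l m =>
    h.closed _ _ _ _ fun t => (h₁ t).2.1 l m, fun l => ?_⟩, by simp [h₂], by simp [h₃]⟩
  exact hD.absorbs _ _ j₀ ((h₁ j₀).2.1 l l) fun t ht => h₄ t ht l

/-- The image of a set under a step. -/
def img (M : A → A → Prop) (B : Set A) : Set A := {b | ∃ a ∈ B, M a b}

variable (C R) in
/-- Propagation of proper subsets of the domains along steps. -/
def Next (D : V → Set A) (p p' : V × Set A) : Prop :=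
  ∃ e : C.Step, C.src e = p.1 ∧ C.tgt e = p'.1 ∧ p'.2 = img (C.stepRel R D e) p.2 ∧
    p'.2 ≠ D p'.1

variable (R f) in
/-- Proper nonempty absorbing subsets of the domains. -/
def Valid (D : V → Set A) (p : V × Set A) : Prop :=
  p.2 ⊆ D p.1 ∧ p.2 ≠ D p.1 ∧ p.2.Nonempty ∧ AbsorbsSet f p.2 {a | R p.1 p.1 a a}

theorem Next.exists_path {D : V → Set A} {p p' : V × Set A}
    (h : Relation.ReflTransGen (C.Next R D) p p') :
    ∃ l, IsPath C.src C.tgt p.1 l p'.1 ∧ p'.2 = img (walk (C.stepRel R D) l) p.2 := by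
  induction h using Relation.ReflTransGen.head_induction_on with
  | refl => exact ⟨[], rfl, by simp [img, walk]⟩
  | head h _ ih =>
    obtain ⟨e, h₁, h₂, h₃, -⟩ := h
    obtain ⟨l, h₄, h₅⟩ := ih
    refine ⟨e :: l, ⟨h₁, h₂ ▸ h₄⟩, ?_⟩
    rw [h₅, h₃]
    ext b
    constructor
    · rintro ⟨a', ⟨a, ha, haa'⟩, hw⟩
      exact ⟨a, ha, a', haa', hw⟩
    · rintro ⟨a, ha, a', haa', hw⟩
      exact ⟨a', ⟨a, ha, haa'⟩, hw⟩

/-- Arc consistency keeps the image nonempty. For absorption, the exceptional coordinate is lifted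
by an unrestricted step and the others by restricted steps starting in `B`. -/
theorem Consistent.valid_img (h : C.Consistent R f) {D : V → Set A} (hD : C.Adm R f D)
    {B : Set A} {e : C.Step} (hB : Valid R f D (C.src e, B))
    (hne : img (C.stepRel R D e) B ≠ D (C.tgt e)) :
    Valid R f D (C.tgt e, img (C.stepRel R D e) B) := by
  obtain ⟨h₁, -, ⟨a, ha⟩, h₄⟩ := hB
  refine ⟨?_, hne, ?_, ?_⟩
  · rintro b ⟨a, -, s, hs, -, rfl⟩
    exact hs.2.2 _
  · obtain ⟨s, hs, hsa⟩ := hD.arc e.1 e.2.1 a (h₁ ha)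
    exact ⟨s e.2.2, a, ha, s, hs, hsa, rfl⟩
  · intro u j₀ h₀ hu
    have h₀' : R (C.tgt e) (C.tgt e) (u j₀) (u j₀) := h₀
    obtain ⟨s₀, g₁, g₂, g₃, g₄⟩ := h.extend e.1 e.2.2 _ _ _ h₀'
    have : ∀ j, ∃ a, (j = j₀ → C.stepRel R (fun _ => Set.univ) e a (u j)) ∧
        (j ≠ j₀ → a ∈ B ∧ C.stepRel R D e a (u j)) := by
      intro j
      by_cases hj : j = j₀
      · subst hj
        exact ⟨s₀ e.2.1, fun _ => ⟨s₀, ⟨g₁, g₄, fun _ => Set.mem_univ _⟩, rfl, g₂⟩,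
          fun e => (e rfl).elim⟩
      · obtain ⟨a, ha, hau⟩ := hu j hj
        exact ⟨a, fun e => (hj e).elim, fun _ => ⟨ha, hau⟩⟩
    choose a ha₁ ha₂ using this
    refine ⟨f a, h₄ a j₀ ?_ fun j hj => (ha₂ j hj).1,
      h.absorbsRel_stepRel hD e a u j₀ (ha₁ j₀ rfl) fun j hj => (ha₂ j hj).2⟩
    exact h.diag _ _ _ _ (stepRel_rel _ _ _ (ha₁ j₀ rfl))

theorem Adm.exists_walk_to {D : V → Set A} (hD : C.Adm R f D)
    {l : List C.Step} {x y : V} (hl : IsPath C.src C.tgt x l y) {d : A} (hd : d ∈ D y) :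
    ∃ d' ∈ D x, walk (C.stepRel R D) l d' d := by
  induction l generalizing x with
  | nil => obtain rfl : x = y := hl; exact ⟨d, hd, rfl⟩
  | cons e l ih =>
    obtain ⟨rfl, hl⟩ := hl
    obtain ⟨d', hd', hw⟩ := ih hl
    obtain ⟨s, hs, hs'⟩ := hD.arc e.1 e.2.2 d' hd'
    exact ⟨s e.2.1, hs.2.2 _, d', ⟨s, hs, rfl, hs'⟩, hw⟩

/-- An admissible family with a domain of more than one element can be shrunk. -/
theorem Consistent.exists_smaller [Finite V] [Finite A] [NeZero N] (h : C.Consistent R f)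
    (hf : ∀ (i : Fin N) (a b : A), f (Function.update (fun _ => b) i a) = b)
    {D : V → Set A} (hD : C.Adm R f D) {x₀ : V} (hx₀ : ¬ (D x₀).Subsingleton) :
    ∃ D', C.Adm R f D' ∧ D' < D := by
  have hidem : ∀ a, f (fun _ => a) = a := fun a => by simpa using hf 0 a a
  obtain ⟨a₀, ha₀⟩ := hD.nonempty x₀
  -- Near-unanimity says precisely that singletons absorb everything.
  have hv₀ : Valid R f D (x₀, {a₀}) := by
    refine ⟨by simpa using ha₀, fun e => hx₀ ?_, by simp, ?_⟩
    · rw [← show ({a₀} : Set A) = D x₀ from e]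
      exact Set.subsingleton_singleton
    · intro u j₀ _ hu
      have : u = Function.update (fun _ => a₀) j₀ (u j₀) := by
        funext j
        by_cases hj : j = j₀
        · subst hj; simp
        · rw [Function.update_of_ne hj]; exact hu j hj
      rw [this, hf]
      rfl
  -- In a terminal component any two propagated subsets reach each other, so each is fixed by a
  -- closed path through the other.
  obtain ⟨t, ht, hterm⟩ := exists_terminal (C.Next R D) (x₀, {a₀})
  have hvalid : ∀ p, Relation.ReflTransGen (C.Next R D) (x₀, {a₀}) p → Valid R f D p := by
    intro p hp
    induction hp with
    | refl => exact hv₀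
    | @tail p p' _ hpp' ih =>
      obtain ⟨e, h₁, h₂, h₃, h₄⟩ := hpp'
      obtain ⟨x, B⟩ := p
      obtain ⟨y, B'⟩ := p'
      simp only at h₁ h₂ h₃ h₄
      subst h₁ h₂ h₃
      exact h.valid_img hD ih h₄
  let K : V × Set A → Prop := Relation.ReflTransGen (C.Next R D) t
  have hKv : ∀ p, K p → Valid R f D p := fun p hp => hvalid p (ht.trans hp)
  have hKK : ∀ p p', K p → K p' → Relation.ReflTransGen (C.Next R D) p p' :=
    fun p p' hp hp' => (hterm p hp).trans hp'
  -- Following the path from `b` to `d` and then one link to `c` shows that `b` and `c` are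
  -- connected, so `mem_of_conn` applies.
  have key : ∀ (y : V) (B : Set A), K (y, B) → ∀ (u : V) (l₁ l₂ : List C.Step),
      IsPath C.src C.tgt y l₁ u → IsPath C.src C.tgt u l₂ y →
      B = img (walk (C.stepRel R D) (l₁ ++ l₂)) B → ∀ b ∈ B, ∀ d c,
      walk (C.stepRel R D) l₁ b d → R u y d c → c ∈ D y → c ∈ B := by
    intro y B hK u l₁ l₂ hl₁ hl₂ hB b hb d c hbd hdc hc
    have hBD := (hKv _ hK).1
    refine mem_of_conn (q := l₁ ++ l₂) (S := C.stepRel R fun _ => Set.univ)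
      (S' := C.stepRel R D) hidem h.eq_of_diag h.symm h.stepRel_extend stepRel_rel
      stepRel_univ (h.absorbsRel_stepRel hD) (hl₁.append hl₂) hBD (hD.sub y)
      (fun d hd => hD.exists_walk_to (hl₁.append hl₂) hd) ?_ ?_ hb hc ?_
    · intro d hd
      rw [hB] at hd
      exact hd
    · intro d hd d' hdd'
      rw [hB]
      exact ⟨d, hd, hdd'⟩
    · refine Relation.ReflTransGen.tail (b := (u, d))
        (conn_of_walk (q₁ := []) (p := l₁) (q₂ := l₂) stepRel_rel (by simp) rfl hl₁ hl₂ hbd)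
        ⟨⟨l₁, l₂, rfl, hl₁, hl₂⟩, ⟨[], l₁ ++ l₂, rfl, rfl, hl₁.append hl₂⟩, hdc⟩
  have himg : ∀ (l₁ l₂ : List C.Step) (B : Set A), img (walk (C.stepRel R D) (l₁ ++ l₂)) B =
      img (walk (C.stepRel R D) l₂) (img (walk (C.stepRel R D) l₁) B) := by
    intro l₁ l₂ B
    ext c
    simp only [img, walk_append, Set.mem_ofPred_eq]
    constructor
    · rintro ⟨a, ha, b, hab, hbc⟩
      exact ⟨b, ⟨a, ha, hab⟩, hbc⟩
    · rintro ⟨b, ⟨a, ha, hab⟩, hbc⟩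
      exact ⟨a, ha, b, hab, hbc⟩
  have hsub : ∀ (x : V) (B B' : Set A), K (x, B) → K (x, B') → B' ⊆ B := by
    intro x B B' hB hB' c hc
    obtain ⟨l₁, hl₁, e₁⟩ := Next.exists_path (hKK _ _ hB hB')
    obtain ⟨l₂, hl₂, e₂⟩ := Next.exists_path (hKK _ _ hB' hB)
    simp only at hl₁ e₁ hl₂ e₂
    have hcD := (hKv _ hB').1 hc
    have hc' := hc
    rw [e₁] at hc'
    obtain ⟨b, hb, hbc⟩ := hc'
    exact key x B hB x l₁ l₂ hl₁ hl₂ (by rw [himg, ← e₁, ← e₂]) b hb c c hbc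
      (hD.sub _ _ hcD) hcD
  let D' : V → Set A := fun x => {a | a ∈ D x ∧ ∀ B, K (x, B) → a ∈ B}
  have hD'K : ∀ x B, K (x, B) → D' x = B := by
    intro x B hB
    ext a
    exact ⟨fun ha => ha.2 B hB, fun ha => ⟨(hKv _ hB).1 ha, fun B' hB' => hsub x B' B hB' hB ha⟩⟩
  have hD'n : ∀ x, (¬ ∃ B, K (x, B)) → D' x = D x := by
    intro x hx
    ext a
    exact ⟨fun ha => ha.1, fun ha => ⟨ha, fun B hB => (hx ⟨B, hB⟩).elim⟩⟩
  refine ⟨D', ⟨fun x a ha => hD.sub x a ha.1, fun x => ?_, fun x => ?_, fun j i a ha => ?_⟩, ?_⟩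
  · by_cases hx : ∃ B, K (x, B)
    · obtain ⟨B, hB⟩ := hx
      rw [hD'K x B hB]
      exact (hKv _ hB).2.2.1
    · rw [hD'n x hx]
      exact hD.nonempty x
  · by_cases hx : ∃ B, K (x, B)
    · obtain ⟨B, hB⟩ := hx
      rw [hD'K x B hB]
      exact (hKv _ hB).2.2.2
    · rw [hD'n x hx]
      exact hD.absorbs x
  -- One restricted variable suffices: a tuple through `a` with its `l`-th entry in `B` has all
  -- other entries in their restricted sets by `key`, the pair relation of the tuple supplying the
  -- last link.
  · by_cases hj : ∃ l B, K (C.scope j l, B)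
    · obtain ⟨l, B, hB⟩ := hj
      obtain ⟨s, hs, hsl, hsi⟩ : ∃ s, C.Loc R D j s ∧ s l ∈ B ∧ s i = a := by
        let e : C.Step := ⟨j, l, i⟩
        have hmem : a ∈ img (C.stepRel R D e) B := by
          by_cases hne : img (C.stepRel R D e) B = D (C.scope j i)
          · rw [hne]; exact ha.1
          · exact ha.2 _ (Relation.ReflTransGen.tail hB ⟨e, rfl, rfl, rfl, hne⟩)
        obtain ⟨b, hb, s, hs, h₁, h₂⟩ := hmem
        exact ⟨s, hs, by rw [show s l = b from h₁]; exact hb, h₂⟩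
      refine ⟨s, ⟨hs.1, hs.2.1, fun m => ⟨hs.2.2 m, fun B' hB' => ?_⟩⟩, hsi⟩
      obtain ⟨l₁, hl₁, e₁⟩ := Next.exists_path (hKK _ _ hB' hB)
      obtain ⟨l₂, hl₂, e₂⟩ := Next.exists_path (hKK _ _ hB hB')
      simp only at hl₁ e₁ hl₂ e₂
      rw [e₁] at hsl
      obtain ⟨b, hb, hbs⟩ := hsl
      exact key _ B' hB' _ l₁ l₂ hl₁ hl₂ (by rw [himg, ← e₁, ← e₂]) b hb _ _ hbs
        (hs.2.1 l m) (hs.2.2 m)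
    · push Not at hj
      obtain ⟨s, hs, hsi⟩ := hD.arc j i a ha.1
      exact ⟨s, ⟨hs.1, hs.2.1, fun l => ⟨hs.2.2 l, fun B hB => (hj l B hB).elim⟩⟩, hsi⟩
  · refine lt_of_le_of_ne (fun x a ha => ha.1) fun e => ?_
    have hK : K (t.1, t.2) := .refl
    have := hD'K t.1 t.2 hK
    rw [e] at this
    exact (hKv _ hK).2.1 this.symm

/-- A consistent system with a near-unanimity polymorphism has a solution. -/
theorem Consistent.exists_solution [Finite V] [Finite A] [NeZero N] (h : C.Consistent R f)
    (hf : ∀ (i : Fin N) (a b : A), f (Function.update (fun _ => b) i a) = b) :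
    ∃ s : V → A, (∀ x, R x x (s x) (s x)) ∧
      ∀ j, 0 < C.ar j → C.rel j fun l => s (C.scope j l) := by
  obtain ⟨D, hD⟩ := Set.Finite.exists_minimal (s := {D | C.Adm R f D}) (Set.toFinite _)
    ⟨_, h.adm⟩
  have hsing : ∀ x, (D x).Subsingleton := by
    intro x
    by_contra hx
    obtain ⟨D', hD', hlt⟩ := h.exists_smaller hf hD.prop hx
    exact hlt.not_ge (hD.le_of_le hD' hlt.le)
  choose s hs using hD.prop.nonempty
  refine ⟨s, fun x => hD.prop.sub _ _ (hs x), fun j hj => ?_⟩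
  -- Arc consistency yields a tuple only through some position, which is why nullary constraints are
  -- excluded.
  obtain ⟨s', hs', -⟩ := hD.prop.arc j ⟨0, hj⟩ _ (hs _)
  have : (fun l => s (C.scope j l)) = s' := funext fun l => hsing _ (hs _) (hs'.2.2 l)
  rw [this]
  exact hs'.1

end System

/-! ### Derived binary relations and the dichotomy for pinned systems. -/

namespace System

section Derivations

variable {V A ι : Type} (C : System V A) (Pin : ι → V → A → Prop)

/-- `C.Der Pin x z T`: the tree `T` denotes a binary relation that contains `(s x, s z)` for
every solution `s` with the prescribed values `Pin`. -/
inductive Der : V → V → Tm ι (A × A) → Prop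
  | top (x z : V) : Der x z Tm.top
  | eq (x : V) : Der x x (.node Empty (fun p _ => p.1 = p.2) Empty.elim)
  | pin (i : ι) (x z : V) (b : A) (h : Pin i x b) : Der x z (.pin i {p | p.1 = b})
  | swap (x z : V) (T : Tm ι (A × A)) (h : Der x z T) :
      Der z x (.node Unit (fun p y => y () = p.swap) fun _ => T)
  | diag (x z : V) (T : Tm ι (A × A)) (h : Der x x T) :
      Der x z (.node Unit (fun p y => y () = (p.1, p.1)) fun _ => T)
  | inter (x z : V) (T : Bool → Tm ι (A × A)) (h : ∀ b, Der x z (T b)) :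
      Der x z (.node Bool (fun p y => ∀ b, y b = p) T)
  | con (j : C.J) (i : Fin (C.ar j)) (z : V)
      (T : Fin (C.ar j) ⊕ Fin (C.ar j) × Fin (C.ar j) → Tm ι (A × A))
      (h : ∀ l, Der (C.scope j l) z (T (.inl l)))
      (h' : ∀ q : Fin (C.ar j) × Fin (C.ar j),
        Der (C.scope j q.1) (C.scope j q.2) (T (.inr q))) :
      Der (C.scope j i) z (.node (Fin (C.ar j) ⊕ Fin (C.ar j) × Fin (C.ar j))
        (fun p y => ∃ s, C.rel j s ∧ s i = p.1 ∧ (∀ l, y (.inl l) = (s l, p.2)) ∧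
          ∀ q : Fin (C.ar j) × Fin (C.ar j), y (.inr q) = (s q.1, s q.2)) T)

variable {N : ℕ} (f : (Fin N → A) → A)

/-- The coordinatewise action of an operation on pairs. -/
def pairOp (u : Fin N → A × A) : A × A := (f fun j => (u j).1, f fun j => (u j).2)

variable {C Pin f}

theorem Der.ok (hf : ∀ (i : Fin N) (a b : A), f (Function.update (fun _ => b) i a) = b)
    (hrel : ∀ j (u : Fin N → Fin (C.ar j) → A), (∀ t, C.rel j (u t)) →
      C.rel j fun l => f fun t => u t l)
    {B : ℕ} (hB : 2 ≤ B) (hB' : ∀ j, C.ar j + C.ar j * C.ar j ≤ B) {x z : V}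
    {T : Tm ι (A × A)} (h : C.Der Pin x z T) : T.Ok (pairOp f) B := by
  induction h with
  | top x z => exact ⟨by simp, fun _ _ _ => trivial, fun l => l.elim⟩
  | eq x =>
    refine ⟨by simp, fun u v h => ?_, fun l => l.elim⟩
    exact congrArg f (funext h)
  | pin i x z b h =>
    intro u j₀ _ hu
    have : (fun j => (u j).1) = Function.update (fun _ => b) j₀ (u j₀).1 := by
      funext j
      by_cases hj : j = j₀
      · subst hj; simp
      · rw [Function.update_of_ne hj]; exact hu j hj
    change f (fun j => (u j).1) = b
    rw [this, hf]
  | swap x z T h ih =>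
    refine ⟨by simp; omega, fun u v h => ?_, fun _ => ih⟩
    simp only [h]
    rfl
  | diag x z T h ih =>
    refine ⟨by simp; omega, fun u v h => ?_, fun _ => ih⟩
    simp only [h]
    rfl
  | inter x z T h ih =>
    refine ⟨by simpa using hB, fun u v h b => ?_, fun b => ih b⟩
    simp only [h]
  | con j i z T h h' ih ih' =>
    refine ⟨by simpa using hB' j, fun u v h => ?_, fun l => ?_⟩
    · choose s h₁ h₂ h₃ h₄ using h
      refine ⟨_, hrel j s h₁, ?_, fun l => ?_, fun q => ?_⟩
      · simp only [h₂]; rfl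
      · simp only [h₃]; rfl
      · simp only [h₄]; rfl
    · cases l with
      | inl l => exact ih l
      | inr q => exact ih' q

/-- Soundness of the derivation rules: a solution obeying all pins except those labelled `i`
satisfies the tree once these leaves are deleted. -/
theorem Der.mem_sem_off {s : V → A} (hs : ∀ j, C.rel j fun l => s (C.scope j l)) {i : ι}
    (hpin : ∀ i', i' ≠ i → ∀ x b, Pin i' x b → s x = b) {x z : V}
    {T : Tm ι (A × A)} (h : C.Der Pin x z T) : (s x, s z) ∈ (T.off i).sem := by
  induction h with
  | top x z => exact ⟨Empty.elim, trivial, fun l => l.elim⟩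
  | eq x => exact ⟨Empty.elim, rfl, fun l => l.elim⟩
  | pin i' x z b h =>
    by_cases hi : i' = i
    · simp only [Tm.off, hi, if_true]
      exact Tm.mem_sem_top _
    · simp only [Tm.off, hi, if_false]
      exact hpin i' hi x b h
  | swap x z T h ih => exact ⟨fun _ => (s x, s z), rfl, fun _ => ih⟩
  | diag x z T h ih => exact ⟨fun _ => (s x, s x), rfl, fun _ => ih⟩
  | inter x z T h ih => exact ⟨fun _ => (s x, s z), fun _ => rfl, ih⟩
  | con j i z T h h' ih ih' =>
    refine ⟨Sum.elim (fun l => (s (C.scope j l), s z))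
      (fun q => (s (C.scope j q.1), s (C.scope j q.2))),
      ⟨_, hs j, rfl, fun _ => rfl, fun _ => rfl⟩, fun l => ?_⟩
    cases l with
    | inl l => exact ih l
    | inr q => exact ih' q

variable (C Pin) in
/-- The intersection of all derived relations. -/
def derRel (x z : V) (a b : A) : Prop := ∀ T, C.Der Pin x z T → (a, b) ∈ T.sem

/-- Only finitely many relations occur and they are closed under intersection, so the least one is
denoted by a single tree. -/
theorem exists_der [Finite A] (x z : V) :
    ∃ T, C.Der Pin x z T ∧ ∀ p ∈ T.sem, C.derRel Pin x z p.1 p.2 := by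
  obtain ⟨S, hS⟩ := Set.Finite.exists_minimal
    (s := {S : Set (A × A) | ∃ T, C.Der Pin x z T ∧ T.sem = S}) (Set.toFinite _)
    ⟨_, _, Der.top x z, rfl⟩
  obtain ⟨T, hT, rfl⟩ := hS.prop
  refine ⟨T, hT, fun p hp T' hT' => ?_⟩
  have hd : C.Der Pin x z (.node Bool (fun p y => ∀ b, y b = p) (fun b => cond b T T')) :=
    Der.inter x z _ fun b => by cases b <;> assumption
  have hle := hS.le_of_le ⟨_, hd, rfl⟩ (by
    rintro p ⟨y, hy, hy'⟩
    have := hy' true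
    rw [hy true] at this
    exact this)
  obtain ⟨y, hy, hy'⟩ := hle hp
  have := hy' false
  rw [hy false] at this
  exact this

/-- Each consistency condition is the closure of derivations under the corresponding rule, applied
where necessary to trees denoting least relations. -/
theorem consistent_derRel [Finite A] [NeZero N]
    (hf : ∀ (i : Fin N) (a b : A), f (Function.update (fun _ => b) i a) = b)
    (hrel : ∀ j (u : Fin N → Fin (C.ar j) → A), (∀ t, C.rel j (u t)) →
      C.rel j fun l => f fun t => u t l)
    {B : ℕ} (hB : 2 ≤ B) (hB' : ∀ j, C.ar j + C.ar j * C.ar j ≤ B)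
    (hne : ∀ x T, C.Der Pin x x T → T.sem.Nonempty) : C.Consistent (C.derRel Pin) f where
  eq_of_diag x a b h := by
    obtain ⟨_, h, -⟩ := h _ (Der.eq x)
    exact h
  symm x z a b h T hT := by
    obtain ⟨y, hy, hy'⟩ := h _ (Der.swap z x T hT)
    have := hy' ()
    rw [hy] at this
    exact this
  diag x z a b h T hT := by
    obtain ⟨y, hy, hy'⟩ := h _ (Der.diag x z T hT)
    have := hy' ()
    rw [hy] at this
    exact this
  closed x z u v h T hT :=
    (hT.ok hf hrel hB hB').closedSet (fun j => (u j, v j)) fun j => h j T hT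
  rel_closed := hrel
  extend j i z a b h := by
    choose T hT hT' using fun x z => exists_der (C := C) (Pin := Pin) x z
    obtain ⟨y, ⟨s, h₁, h₂, h₃, h₄⟩, hy⟩ := h _ (Der.con j i z
      (Sum.elim (fun l => T (C.scope j l) z) (fun q => T (C.scope j q.1) (C.scope j q.2)))
      (fun l => hT _ _) (fun q => hT _ _))
    refine ⟨s, h₁, h₂, fun l => ?_, fun l m => ?_⟩
    · have := hy (.inl l)
      rw [h₃] at this
      exact hT' _ _ _ this
    · have := hy (.inr (l, m))
      rw [h₄] at this
      exact hT' _ _ _ this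
  nonempty x := by
    obtain ⟨T, hT, hT'⟩ := exists_der (C := C) (Pin := Pin) x x
    obtain ⟨p, hp⟩ := hne x T hT
    have h := hT' p hp
    obtain ⟨_, he, -⟩ := h _ (Der.eq x)
    have he' : p.1 = p.2 := he
    exact ⟨p.1, by rw [← he'] at h; exact h⟩

/-- If a system with a near-unanimity polymorphism has no solution with prescribed values, but has
one as soon as the values with any one label are released, then there are few labels. -/
theorem exists_solution_or_card_le [Finite V] [Finite A] [NeZero N]
    (hf : ∀ (i : Fin N) (a b : A), f (Function.update (fun _ => b) i a) = b)
    (hrel : ∀ j (u : Fin N → Fin (C.ar j) → A), (∀ t, C.rel j (u t)) →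
      C.rel j fun l => f fun t => u t l)
    {B : ℕ} (hB : 2 ≤ B) (hB' : ∀ j, C.ar j + C.ar j * C.ar j ≤ B)
    (hpin : ∀ i, ∃ s : V → A, (∀ j, C.rel j fun l => s (C.scope j l)) ∧
      ∀ i', i' ≠ i → ∀ x b, Pin i' x b → s x = b) :
    (∃ s : V → A, (∀ i x b, Pin i x b → s x = b) ∧
      ∀ j, 0 < C.ar j → C.rel j fun l => s (C.scope j l)) ∨
    Nat.card ι ≤ B ^ 3 ^ (Nat.card A ^ 2) := by
  by_cases hne : ∀ x T, C.Der Pin x x T → T.sem.Nonempty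
  · left
    obtain ⟨s, hs, hs'⟩ := (consistent_derRel hf hrel hB hB' hne).exists_solution hf
    exact ⟨s, fun i x b h => hs x _ (Der.pin i x x b h), hs'⟩
  · right
    push Not at hne
    obtain ⟨x, T, hT, hemp⟩ := hne
    have := Tm.card_labels_le (by omega) T (hT.ok hf hrel hB hB') hemp fun i => by
      obtain ⟨s, hs, hs'⟩ := hpin i
      exact ⟨_, hT.mem_sem_off hs hs'⟩
    rwa [Nat.card_prod, ← sq] at this

end Derivations

end System

/-! ### The arity bound for polymorphisms. -/

theorem two_mul_three_pow_le {K : ℕ} (hK : 4 ≤ K) : 2 * 3 ^ K ≤ 2 ^ (2 * K) := by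
  rw [pow_mul]
  induction K, hK using Nat.le_induction with
  | base => norm_num
  | succ K _ ih => rw [pow_succ, pow_succ]; omega

/-- The constraint system whose solutions are the operations of arity `n` preserving `G`. -/
def polySystem {k : ℕ} (G : Finset (Predicate k)) (n : ℕ) :
    System (Fin n → Fin k) (Fin k) where
  J := {p : Σ ρ : Predicate k, (Fin n → Fin ρ.1 → Fin k) // p.1 ∈ G ∧ ∀ j, p.1.2 (p.2 j) = true}
  ar p := p.1.1.1
  rel p s := p.1.1.2 s = true
  scope p l := fun j => p.1.2 j l

theorem admitsNUFOfArity_nufArity {k : ℕ} (hk : 2 ≤ k) {G : Finset (Predicate k)}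
    (h : AdmitsNUF G) : AdmitsNUFOfArity G (nufArity G) := by
  obtain ⟨N, hN, f, hf, hfG⟩ := h
  have : NeZero N := ⟨by omega⟩
  set r := max 1 (maxArity G) with hr
  have hr1 : 1 ≤ r := le_max_left _ _
  set n := nufArity G with hn
  have hn' : n = (k * r) ^ (2 ^ (2 * k ^ 2) + 2) := rfl
  have hkr : 2 ≤ k * r := by nlinarith
  have hn0 : 0 < n := by rw [hn']; positivity
  have har : ∀ ρ ∈ G, ρ.1 ≤ r := fun ρ hρ =>
    (Finset.le_sup (f := fun ρ : Predicate k => ρ.1) hρ).trans (le_max_right _ _)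
  have hB : ∀ j, (polySystem G n).ar j + (polySystem G n).ar j * (polySystem G n).ar j ≤
      (k * r) ^ 2 := by
    intro j
    have h₁ : (polySystem G n).ar j ≤ r := har _ j.2.1
    generalize (polySystem G n).ar j = m at h₁
    have h₂ : m * m ≤ r * r := Nat.mul_le_mul h₁ h₁
    -- A constraint rule has at most `r + r * r` premises, and `k ≥ 2` makes `(k * r) ^ 2` large
    -- enough.
    have h₃ : 4 * (r * r) ≤ (k * r) ^ 2 := by
      calc 4 * (r * r) = (2 * r) ^ 2 := by ring
        _ ≤ (k * r) ^ 2 := Nat.pow_le_pow_left (Nat.mul_le_mul_right _ hk) 2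
    nlinarith
  have hpin : ∀ i : Fin n, ∃ s : (Fin n → Fin k) → Fin k,
      (∀ j, (polySystem G n).rel j fun l => s ((polySystem G n).scope j l)) ∧
      ∀ i', i' ≠ i → ∀ x b, (∃ a, x = Function.update (fun _ => b) i' a) → s x = b := by
    intro i
    -- The `i`-th projection violates only near-unanimity at position `i`.
    refine ⟨fun x => x i, fun j => j.2.2 i, ?_⟩
    rintro i' hi x b ⟨a, rfl⟩
    simp [Ne.symm hi]
  rcases System.exists_solution_or_card_le (C := polySystem G n) hf
    (fun j u hu => hfG _ j.2.1 u hu) (by nlinarith) hB hpin with h | h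
  · obtain ⟨s, hs, hs'⟩ := h
    refine ⟨s, fun i a b => hs i _ b ⟨a, rfl⟩, fun ρ hρ α hα => ?_⟩
    rcases Nat.eq_zero_or_pos ρ.1 with h0 | h0
    · have : IsEmpty (Fin ρ.1) := by rw [h0]; infer_instance
      rw [Subsingleton.elim (fun i => s fun j => α j i) (α ⟨0, hn0⟩)]
      exact hα _
    · exact hs' ⟨⟨ρ, α⟩, hρ, hα⟩ h0
  · exfalso
    rw [Nat.card_fin, Nat.card_fin, ← pow_mul] at h
    have hK : 4 ≤ k ^ 2 := by nlinarith
    have h₁ := two_mul_three_pow_le hK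
    -- With `B = (k * r) ^ 2` the leaf bound has exponent `2 * 3 ^ k ^ 2`; the `+ 2` in `nufArity`
    -- makes the inequality strict.
    have : (k * r) ^ (2 * 3 ^ k ^ 2) < (k * r) ^ (2 ^ (2 * k ^ 2) + 2) :=
      Nat.pow_lt_pow_right (by omega) (by omega)
    omega

theorem admitsNUFOfArity_of_le_one {k : ℕ} (hk : k ≤ 1) (G : Finset (Predicate k)) {n : ℕ}
    (hn : 0 < n) : AdmitsNUFOfArity G n := by
  have : Subsingleton (Fin k) := Fin.subsingleton_iff_le_one.2 hk
  refine ⟨fun x => x ⟨0, hn⟩, fun _ _ _ => Subsingleton.elim _ _, fun ρ _ α hα => ?_⟩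
  exact hα ⟨0, hn⟩

theorem admitsNUF_iff {k : ℕ} (hk : 1 ≤ k) (G : Finset (Predicate k)) :
    AdmitsNUF G ↔ AdmitsNUFOfArity G (nufArity G) := by
  have hr1 : 1 ≤ max 1 (maxArity G) := le_max_left _ _
  rcases Nat.lt_or_ge 1 k with h | h
  · refine ⟨admitsNUFOfArity_nufArity h, fun h' => ⟨_, ?_, h'⟩⟩
    calc 3 ≤ 2 ^ 2 := by norm_num
      _ ≤ (k * max 1 (maxArity G)) ^ 2 := Nat.pow_le_pow_left (by nlinarith) 2
      _ ≤ nufArity G := Nat.pow_le_pow_right (by nlinarith) (Nat.le_add_left 2 _)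
  · refine ⟨fun _ => admitsNUFOfArity_of_le_one h G ?_,
      fun _ => ⟨3, le_rfl, admitsNUFOfArity_of_le_one h G (by norm_num)⟩⟩
    unfold nufArity
    positivity

/-! ### Primitive recursive search through digit codes. -/

section Primrec

variable {α β : Type} [Primcodable α] [Primcodable β]

theorem primrecPred_forall_lt {p : α → ℕ → Prop} {b : α → ℕ} (hb : Primrec b)
    (hp : PrimrecPred fun q : α × ℕ => p q.1 q.2) : PrimrecPred fun a => ∀ x < b a, p a x := by
  have hR : PrimrecRel fun (x : ℕ) (a : α) => p a x :=
    hp.comp (Primrec.pair Primrec.snd Primrec.fst)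
  exact (hR.forall_mem_list.comp (Primrec.list_range.comp hb) Primrec.id).of_eq (by simp)

theorem primrecPred_exists_lt {p : α → ℕ → Prop} {b : α → ℕ} (hb : Primrec b)
    (hp : PrimrecPred fun q : α × ℕ => p q.1 q.2) : PrimrecPred fun a => ∃ x < b a, p a x := by
  have hR : PrimrecRel fun (x : ℕ) (a : α) => p a x :=
    hp.comp (Primrec.pair Primrec.snd Primrec.fst)
  exact (hR.exists_mem_list.comp (Primrec.list_range.comp hb) Primrec.id).of_eq (by simp)

theorem primrecPred_forall_mem {p : α → β → Prop} {L : α → List β} (hL : Primrec L)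
    (hp : PrimrecPred fun q : α × β => p q.1 q.2) : PrimrecPred fun a => ∀ x ∈ L a, p a x := by
  have hR : PrimrecRel fun (x : β) (a : α) => p a x :=
    hp.comp (Primrec.pair Primrec.snd Primrec.fst)
  exact (hR.forall_mem_list.comp hL Primrec.id).of_eq (by simp)

theorem primrecPred_mem {x : α → β} {L : α → List β} (hx : Primrec x) (hL : Primrec L) :
    PrimrecPred fun a => x a ∈ L a := by
  have hR : PrimrecRel fun (y : β) (z : β) => y = z := Primrec.eq
  exact (hR.exists_mem_list.comp hL hx).of_eq (by simp)

theorem primrecPred_imp {p q : α → Prop} (hp : PrimrecPred p) (hq : PrimrecPred q) :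
    PrimrecPred fun a => p a → q a :=
  (hp.not.or hq).of_eq fun _ => imp_iff_not_or.symm

theorem primrec_pow : Primrec₂ ((· ^ ·) : ℕ → ℕ → ℕ) := Primrec₂.unpaired'.1 Nat.Primrec.pow

end Primrec

/-- The `i`-th digit of `t` in base `k`. -/
def digit (k t i : ℕ) : ℕ := t / k ^ i % k

/-- The `j`-th block of `r` digits of `v` in base `k`. -/
def row (k r v j : ℕ) : List ℕ := (List.range r).map fun i => digit k v (i + r * j)

/-- The operation of arity `n` whose table has the digits of `t` is a near-unanimity function. -/
def CodeNU (k n t : ℕ) : Prop :=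
  ∀ u < k ^ n, ∀ i < n, ∀ b < k, (∀ j < n, j ≠ i → digit k u j = b) → digit k t u = b

/-- The operation of arity `n` whose table has the digits of `t` preserves a listed predicate. -/
def CodePres (k n t : ℕ) (c : ℕ × List (List ℕ)) : Prop :=
  ∀ v < k ^ (n * c.1), (∀ j < n, row k c.1 v j ∈ c.2) →
    ∃ w < k ^ c.1, row k c.1 w 0 ∈ c.2 ∧ ∀ i < c.1, ∃ u < k ^ n,
      (∀ j < n, digit k u j = digit k v (i + c.1 * j)) ∧ digit k w i = digit k t u

section Primrec

variable {α : Type} [Primcodable α]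

theorem primrec_digit {K T I : α → ℕ} (hK : Primrec K) (hT : Primrec T) (hI : Primrec I) :
    Primrec fun a => digit (K a) (T a) (I a) :=
  Primrec.nat_mod.comp (Primrec.nat_div.comp hT (primrec_pow.comp hK hI)) hK

theorem primrec_row {K r v j : α → ℕ} (hK : Primrec K) (hr : Primrec r) (hv : Primrec v)
    (hj : Primrec j) : Primrec fun a => row (K a) (r a) (v a) (j a) := by
  refine Primrec.list_map (Primrec.list_range.comp hr) ?_
  exact primrec_digit (hK.comp .fst) (hv.comp .fst)
    (Primrec.nat_add.comp .snd (Primrec.nat_mul.comp (hr.comp .fst) (hj.comp .fst)))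

theorem primrecPred_codeNU {K n t : α → ℕ} (hK : Primrec K) (hn : Primrec n)
    (ht : Primrec t) : PrimrecPred fun a => CodeNU (K a) (n a) (t a) := by
  unfold CodeNU
  refine primrecPred_forall_lt (primrec_pow.comp hK hn) ?_
  refine primrecPred_forall_lt (hn.comp .fst) ?_
  refine primrecPred_forall_lt (hK.comp (.comp .fst .fst)) ?_
  refine primrecPred_imp (primrecPred_forall_lt (hn.comp (.comp .fst (.comp .fst .fst)))
    (primrecPred_imp (PrimrecPred.not ?_) ?_)) ?_
  · exact Primrec.eq.comp .snd (.comp .snd (.comp .fst .fst))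
  · refine Primrec.eq.comp (primrec_digit (hK.comp ?_) ?_ .snd) (.comp .snd .fst)
    · exact .comp .fst (.comp .fst (.comp .fst .fst))
    · exact .comp .snd (.comp .fst (.comp .fst .fst))
  · refine Primrec.eq.comp (primrec_digit (hK.comp ?_) (ht.comp ?_) ?_) .snd
    · exact .comp .fst (.comp .fst .fst)
    · exact .comp .fst (.comp .fst .fst)
    · exact .comp .snd (.comp .fst .fst)

theorem primrecPred_codePres {K n t : α → ℕ} {c : α → ℕ × List (List ℕ)} (hK : Primrec K)
    (hn : Primrec n) (ht : Primrec t) (hc : Primrec c) :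
    PrimrecPred fun a => CodePres (K a) (n a) (t a) (c a) := by
  have hr : Primrec fun a => (c a).1 := .comp .fst hc
  have hL : Primrec fun a => (c a).2 := .comp .snd hc
  unfold CodePres
  refine primrecPred_forall_lt (primrec_pow.comp hK (Primrec.nat_mul.comp hn hr)) ?_
  refine primrecPred_imp (primrecPred_forall_lt (hn.comp .fst) ?_)
    (primrecPred_exists_lt (primrec_pow.comp (hK.comp .fst) (hr.comp .fst))
      (PrimrecPred.and ?_ (primrecPred_forall_lt (hr.comp (.comp .fst .fst))
        (primrecPred_exists_lt ?_ (PrimrecPred.and (primrecPred_forall_lt ?_ ?_) ?_)))))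
  · have h : Primrec fun q : (α × ℕ) × ℕ => q.1.1 := .comp .fst .fst
    exact primrecPred_mem (primrec_row (hK.comp h) (hr.comp h) (.comp .snd .fst) .snd)
      (hL.comp h)
  · have h : Primrec fun q : (α × ℕ) × ℕ => q.1.1 := .comp .fst .fst
    exact primrecPred_mem (primrec_row (hK.comp h) (hr.comp h) .snd (.const 0)) (hL.comp h)
  · have h : Primrec fun q : ((α × ℕ) × ℕ) × ℕ => q.1.1.1 := .comp .fst (.comp .fst .fst)
    exact primrec_pow.comp (hK.comp h) (hn.comp h)
  · have h : Primrec fun q : (((α × ℕ) × ℕ) × ℕ) × ℕ => q.1.1.1.1 :=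
      .comp .fst (.comp .fst (.comp .fst .fst))
    exact hn.comp h
  · have h : Primrec fun q : ((((α × ℕ) × ℕ) × ℕ) × ℕ) × ℕ => q.1.1.1.1 :=
      .comp .fst (.comp .fst (.comp .fst .fst))
    have h' : Primrec fun q : ((((α × ℕ) × ℕ) × ℕ) × ℕ) × ℕ => q.1.1.1.1.1 := .comp .fst h
    have hi : Primrec fun q : ((((α × ℕ) × ℕ) × ℕ) × ℕ) × ℕ => q.1.1.2 :=
      .comp .snd (.comp .fst .fst)
    exact Primrec.eq.comp (primrec_digit (hK.comp h') (.comp .snd .fst) .snd)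
      (primrec_digit (hK.comp h') (.comp .snd h)
        (Primrec.nat_add.comp hi (Primrec.nat_mul.comp (hr.comp h') .snd)))
  · have h : Primrec fun q : (((α × ℕ) × ℕ) × ℕ) × ℕ => q.1.1.1.1 :=
      .comp .fst (.comp .fst (.comp .fst .fst))
    have hw : Primrec fun q : (((α × ℕ) × ℕ) × ℕ) × ℕ => q.1.1.2 :=
      .comp .snd (.comp .fst .fst)
    exact Primrec.eq.comp (primrec_digit (hK.comp h) hw (.comp .snd .fst))
      (primrec_digit (hK.comp h) (ht.comp h) .snd)

end Primrec

section Codes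

variable {k : ℕ}

/-- `v` is the number whose `m` digits in base `k` are the entries of `x`. -/
def Codes (v : ℕ) {m : ℕ} (x : Fin m → Fin k) : Prop :=
  v < k ^ m ∧ ∀ i : Fin m, digit k v i = x i

theorem exists_codes {m : ℕ} (x : Fin m → Fin k) : ∃ v, Codes v x := by
  refine ⟨finFunctionFinEquiv x, (finFunctionFinEquiv x).2, fun i => ?_⟩
  have := finFunctionFinEquiv_symm_apply_val (finFunctionFinEquiv x) i
  rw [Equiv.symm_apply_apply] at this
  exact this.symm

theorem exists_codes_of_lt {m v : ℕ} (hv : v < k ^ m) : ∃ x : Fin m → Fin k, Codes v x :=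
  ⟨finFunctionFinEquiv.symm ⟨v, hv⟩, hv, fun i =>
    (finFunctionFinEquiv_symm_apply_val ⟨v, hv⟩ i).symm⟩

theorem Codes.unique {m v v' : ℕ} {x : Fin m → Fin k} (h : Codes v x) (h' : Codes v' x) :
    v = v' := by
  have : (⟨v, h.1⟩ : Fin (k ^ m)) = ⟨v', h'.1⟩ := by
    apply finFunctionFinEquiv.symm.injective
    funext i
    apply Fin.ext
    rw [finFunctionFinEquiv_symm_apply_val, finFunctionFinEquiv_symm_apply_val]
    exact (h.2 i).trans (h'.2 i).symm
  exact congrArg Fin.val this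

/-- The digits of `t` are the table of `f`. -/
def Represents (t : ℕ) {n : ℕ} (f : Op k n) : Prop :=
  ∀ (x : Fin n → Fin k) (u : ℕ), Codes u x → digit k t u = f x

theorem exists_represents {n : ℕ} (f : Op k n) : ∃ t < k ^ k ^ n, Represents t f := by
  obtain ⟨t, ht, ht'⟩ := exists_codes (k := k) (m := k ^ n)
    fun u => f (finFunctionFinEquiv.symm u)
  refine ⟨t, ht, fun x u hu => ?_⟩
  rw [ht' ⟨u, hu.1⟩]
  refine congrArg Fin.val (congrArg f (funext fun i => ?_))
  exact Fin.ext ((finFunctionFinEquiv_symm_apply_val _ _).trans (hu.2 i))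

/-- Reduction mod `k` makes every number a valid table, so the search needs no well-formedness test.
-/
theorem exists_op_represents (hk : 0 < k) (n t : ℕ) : ∃ f : Op k n, Represents t f := by
  choose enc henc using fun x : Fin n → Fin k => exists_codes x
  refine ⟨fun x => ⟨digit k t (enc x), Nat.mod_lt _ hk⟩, fun x u hu => ?_⟩
  rw [hu.unique (henc x)]

theorem Represents.codeNU_iff {n t : ℕ} {f : Op k n} (h : Represents t f) :
    CodeNU k n t ↔ IsNearUnanimity f := by
  constructor
  · intro hc i a b
    obtain ⟨u, hu⟩ := exists_codes (Function.update (fun _ => b) i a)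
    refine Fin.ext ?_
    rw [← h _ u hu]
    refine hc u hu.1 i i.2 b b.2 fun j hj hji => ?_
    rw [hu.2 ⟨j, hj⟩, Function.update_of_ne fun e => hji (congrArg Fin.val e)]
  · intro hf u hu i hi b hb hj
    obtain ⟨x, hx⟩ := exists_codes_of_lt hu
    have : x = Function.update (fun _ => ⟨b, hb⟩) ⟨i, hi⟩ (x ⟨i, hi⟩) := by
      funext j
      by_cases hji : j = ⟨i, hi⟩
      · subst hji; simp
      · rw [Function.update_of_ne hji]
        refine Fin.ext ?_
        rw [← hx.2 j]
        exact hj j j.2 fun e => hji (Fin.ext e)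
    rw [h x u hx, this, hf]

theorem row_eq_ofFn {r v j : ℕ} {x : Fin r → Fin k}
    (h : ∀ i : Fin r, digit k v (i + r * j) = x i) :
    row k r v j = List.ofFn fun i => (x i : ℕ) := by
  unfold row
  apply List.ext_getElem
  · simp
  · intro i h₁ h₂
    have hi : i < r := by simpa using h₁
    simpa using h ⟨i, hi⟩

/-- An `n × r` matrix is read as one string of `n * r` digits, entry `(j, i)` at index `i + r * j`,
the convention of `finProdFinEquiv`. Columns and the resulting tuple are quantified by their codes,
which keeps all quantifiers bounded. -/
theorem Represents.codePres_iff {n t : ℕ} {f : Op k n} (h : Represents t f)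
    (c : ℕ × List (List ℕ)) : CodePres k n t c ↔ Preserves f (decodePredicate k c) := by
  obtain ⟨r, L⟩ := c
  simp only [CodePres, Preserves, decodePredicate, decide_eq_true_eq]
  constructor
  · intro hc α hα
    obtain ⟨v, hv⟩ := exists_codes (k := k) fun q : Fin (n * r) =>
      α (finProdFinEquiv.symm q).1 (finProdFinEquiv.symm q).2
    have hdig : ∀ (j : Fin n) (i : Fin r), digit k v (i + r * j) = α j i := by
      intro j i
      have := hv.2 (finProdFinEquiv (j, i))
      beta_reduce at this
      rw [Equiv.symm_apply_apply] at this
      exact this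
    obtain ⟨w, hw, hwL, hwt⟩ := hc v hv.1 fun j hj => by
      rw [row_eq_ofFn (hdig ⟨j, hj⟩)]
      exact hα ⟨j, hj⟩
    rwa [row_eq_ofFn (x := fun i => f fun j => α j i)] at hwL
    intro i
    obtain ⟨u, hu, hud, hwu⟩ := hwt i i.2
    rw [mul_zero, add_zero, hwu]
    exact h _ u ⟨hu, fun j => (hud j j.2).trans (hdig j i)⟩
  · intro hf v hv hrows
    obtain ⟨y, hy⟩ := exists_codes_of_lt hv
    let α : Fin n → Fin r → Fin k := fun j i => y (finProdFinEquiv (j, i))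
    have hdig : ∀ (j : Fin n) (i : Fin r), digit k v (i + r * j) = α j i :=
      fun j i => hy.2 (finProdFinEquiv (j, i))
    obtain ⟨w, hw⟩ := exists_codes fun i => f fun j => α j i
    refine ⟨w, hw.1, ?_, fun i hi => ?_⟩
    · rw [row_eq_ofFn (x := fun i => f fun j => α j i) (by simpa using hw.2)]
      refine hf α fun j => ?_
      rw [← row_eq_ofFn (hdig j)]
      exact hrows j j.2
    · obtain ⟨u, hu⟩ := exists_codes fun j => α j ⟨i, hi⟩
      refine ⟨u, hu.1, fun j hj => ?_, ?_⟩
      · rw [hu.2 ⟨j, hj⟩]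
        exact (hdig ⟨j, hj⟩ ⟨i, hi⟩).symm
      · rw [h _ u hu]
        exact hw.2 ⟨i, hi⟩

theorem admitsNUFOfArity_iff_code (hk : 0 < k) (l : List (ℕ × List (List ℕ))) (n : ℕ) :
    AdmitsNUFOfArity (Instance.predicates (k, l)) n ↔
      ∃ t < k ^ k ^ n, CodeNU k n t ∧ ∀ c ∈ l, CodePres k n t c := by
  simp only [AdmitsNUFOfArity, Instance.predicates, List.mem_toFinset, List.mem_map,
    forall_exists_index, and_imp, forall_apply_eq_imp_iff₂]
  constructor
  · rintro ⟨f, hf, hG⟩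
    obtain ⟨t, ht, h⟩ := exists_represents f
    exact ⟨t, ht, h.codeNU_iff.2 hf, fun c hc => (h.codePres_iff c).2 (hG c hc)⟩
  · rintro ⟨t, -, ht, hG⟩
    obtain ⟨f, h⟩ := exists_op_represents hk n t
    exact ⟨f, h.codeNU_iff.1 ht, fun c hc => (h.codePres_iff c).1 (hG c hc)⟩

end Codes

/-! ### The decision problems, including the empty ground set. -/

theorem admitsNUFOfArity_zero_iff (G : Finset (Predicate 0)) (n : ℕ) :
    AdmitsNUFOfArity G n ↔ 0 < n := by
  refine ⟨fun ⟨f, _⟩ => ?_, admitsNUFOfArity_of_le_one zero_le_one G⟩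
  rcases Nat.eq_zero_or_pos n with rfl | h
  · exact (f Fin.elim0).elim0
  · exact h

theorem primrecPred_admitsNUFOfArity :
    PrimrecPred fun p : Instance × ℕ => AdmitsNUFOfArity p.1.predicates p.2 := by
  have hK : Primrec fun p : Instance × ℕ => p.1.1 := .comp .fst .fst
  have hl : Primrec fun p : Instance × ℕ => p.1.2 := .comp .snd .fst
  have hn : Primrec fun p : Instance × ℕ => p.2 := .snd
  have hmain : PrimrecPred fun p : Instance × ℕ => ∃ t < p.1.1 ^ p.1.1 ^ p.2,
      CodeNU p.1.1 p.2 t ∧ ∀ c ∈ p.1.2, CodePres p.1.1 p.2 t c := by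
    refine primrecPred_exists_lt (primrec_pow.comp hK (primrec_pow.comp hK hn))
      (PrimrecPred.and (primrecPred_codeNU (hK.comp .fst) (hn.comp .fst) .snd)
        (primrecPred_forall_mem (hl.comp .fst) ?_))
    have h : Primrec fun q : ((Instance × ℕ) × ℕ) × (ℕ × List (List ℕ)) => q.1.1 :=
      .comp .fst .fst
    exact primrecPred_codePres (hK.comp h) (hn.comp h) (.comp .snd .fst) .snd
  have hzero : PrimrecPred fun p : Instance × ℕ => p.1.1 = 0 := Primrec.eq.comp hK (.const 0)
  have hpos : PrimrecPred fun p : Instance × ℕ => 0 < p.2 := Primrec.nat_lt.comp (.const 0) hn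
  refine ((hzero.and hpos).or (hzero.not.and hmain)).of_eq ?_
  rintro ⟨⟨k, l⟩, n⟩
  rcases Nat.eq_zero_or_pos k with rfl | hk
  · simp [admitsNUFOfArity_zero_iff]
  · rw [admitsNUFOfArity_iff_code hk]
    simp [hk.ne']

theorem maxArity_predicates (c : Instance) :
    maxArity c.predicates = c.2.foldr (fun p m => max p.1 m) 0 := by
  obtain ⟨k, l⟩ := c
  simp only [maxArity, Instance.predicates]
  induction l with
  | nil => simp
  | cons p l ih =>
    simp only [List.map_cons, List.toFinset_cons, Finset.sup_insert, List.foldr_cons, ih]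
    rfl

theorem primrec_nufArity : Primrec fun c : Instance => nufArity c.predicates := by
  have hK : Primrec fun c : Instance => c.1 := .fst
  have hmax : Primrec fun c : Instance => maxArity c.predicates := by
    refine (Primrec.list_foldr (h := fun _ q => max q.1.1 q.2) .snd (.const 0) ?_).of_eq
      fun c => (maxArity_predicates c).symm
    exact Primrec.nat_max.comp (.comp .fst (.comp .fst .snd)) (.comp .snd .snd)
  exact primrec_pow.comp (Primrec.nat_mul.comp hK (Primrec.nat_max.comp (.const 1) hmax))
    (Primrec.nat_add.comp (primrec_pow.comp (.const 2) (Primrec.nat_mul.comp (.const 2)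
      (primrec_pow.comp hK (.const 2)))) (.const 2))

theorem primrecPred_admitsNUF : PrimrecPred fun c : Instance => AdmitsNUF c.predicates := by
  -- Inputs may have `k = 0`. Then `nufArity` is `0` and no nullary operation exists, although
  -- operations of arity `3` do, so this case is decided apart.
  have hzero : PrimrecPred fun c : Instance => c.1 = 0 := Primrec.eq.comp .fst (.const 0)
  refine (hzero.or (primrecPred_admitsNUFOfArity.comp
    (Primrec.pair .id primrec_nufArity))).of_eq ?_
  rintro ⟨k, l⟩
  rcases Nat.eq_zero_or_pos k with rfl | hk
  · exact ⟨fun _ => ⟨3, le_rfl, admitsNUFOfArity_of_le_one zero_le_one _ (by norm_num)⟩,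
      fun _ => Or.inl rfl⟩
  · rw [admitsNUF_iff hk]
    simp [hk.ne']

theorem computablePred_of_primrecPred {α : Type} [Primcodable α] {p : α → Prop}
    (h : PrimrecPred p) : ComputablePred p :=
  let ⟨d, hd⟩ := h
  ⟨d, hd.to_comp⟩

end NUF

theorem mainTheorem2 :
    ComputablePred (fun c : NUF.Instance => NUF.AdmitsNUF c.predicates) ∧
    (∀ (k : ℕ), 1 ≤ k → ∀ G : Finset (NUF.Predicate k),
      (NUF.AdmitsNUF G ↔ NUF.AdmitsNUFOfArity G (NUF.nufArity G))) ∧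
    Computable (fun c : NUF.Instance => NUF.nufArity c.predicates) ∧
    ComputablePred (fun p : NUF.Instance × ℕ =>
      NUF.AdmitsNUFOfArity p.1.predicates p.2) :=
  ⟨NUF.computablePred_of_primrecPred NUF.primrecPred_admitsNUF,
    fun _ hk G => NUF.admitsNUF_iff hk G,
    NUF.primrec_nufArity.to_comp,
    NUF.computablePred_of_primrecPred NUF.primrecPred_admitsNUFOfArity⟩
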